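/- Let $E$ be a real Banach lattice that is countably order complete, i.e. every nonempty countable subset of $E$ that is bounded above has a supremum. A bounded linear operator $T\colon E\to E$ is called positive if $Tx\ge 0$ for all $x\ge 0$; power-bounded if $\sup_{n\ge 0}\|T^n\|<\infty$; mean ergodic if $\lim_{n\to\infty}\frac1n\sum_{k=0}^{n-1}T^kx$ exists in norm for every $x\in E$; and weakly almost periodic if, for every $x\in E$, the orbit $\{T^nx : n\ge 0\}$ is relatively compact in the weak topology of $E$. Suppose that every positive, power-bounded and mean ergodic operator on $E$ is weakly almost periodic. Then $E$ is a KB-space, i.e. every norm bounded increasing sequence in the positive cone $E_+$ converges in norm. -/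

import Mathlib

open Filter Topology

/-- Countable (Dedekind `σ`-) order completeness: every nonempty countable set that is bounded
above has a supremum. -/
def IsCountablyOrderComplete (E : Type*) [PartialOrder E] : Prop :=
  ∀ s : Set E, s.Countable → s.Nonempty → BddAbove s → ∃ a, IsLUB s a

/-- The KB-property of a normed lattice: every norm bounded increasing sequence in the positive
cone converges in norm. -/
def IsKBSpace (E : Type*) [NormedAddCommGroup E] [PartialOrder E] : Prop :=
  ∀ u : ℕ → E, (∀ n, 0 ≤ u n) → Monotone u → (∃ C : ℝ, ∀ n, ‖u n‖ ≤ C) →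
    ∃ a, Tendsto u atTop (𝓝 a)

/-- A positive operator maps the positive cone into itself. -/
def IsPositiveOperator {E : Type*} [NormedAddCommGroup E] [NormedSpace ℝ E] [PartialOrder E]
    (T : E →L[ℝ] E) : Prop :=
  ∀ x, 0 ≤ x → 0 ≤ T x

/-- An operator is power-bounded if the operator norms of its powers are bounded. -/
def IsPowerBounded {E : Type*} [NormedAddCommGroup E] [NormedSpace ℝ E]
    (T : E →L[ℝ] E) : Prop :=
  ∃ C : ℝ, ∀ n : ℕ, ‖T ^ n‖ ≤ C

/-- An operator is mean ergodic if its Cesàro averages converge strongly. -/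
def IsMeanErgodic {E : Type*} [NormedAddCommGroup E] [NormedSpace ℝ E]
    (T : E →L[ℝ] E) : Prop :=
  ∀ x, ∃ y, Tendsto (fun n : ℕ => (n : ℝ)⁻¹ • ∑ k ∈ Finset.range n, (T ^ k) x) atTop (𝓝 y)

/-- An operator is weakly almost periodic if each of its orbits is relatively compact in the weak
topology, i.e. has compact closure in the (Hausdorff) space `WeakSpace ℝ E`. -/
def IsWeaklyAlmostPeriodic {E : Type*} [NormedAddCommGroup E] [NormedSpace ℝ E]
    (T : E →L[ℝ] E) : Prop :=
  ∀ x, IsCompact (closure (toWeakSpace ℝ E '' Set.range fun n : ℕ => (T ^ n) x))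

/-!
If `E` is not a KB-space, it contains a positively complemented copy `F` of a classical sequence
space: there are positive maps `Φ : E → F` and `J : F → E` with `Φ ∘ J = id`. An operator `D` on `F`
then yields the operator `J ∘ D ∘ Φ` on `E`, which inherits positivity, power-boundedness and mean
ergodicity, and which is weakly almost periodic only if `D` is
(`isWeaklyAlmostPeriodic_of_retract`). So it is enough to have, on `F`, a positive, power-bounded,
mean ergodic operator that is not weakly almost periodic. Two cases are needed, since mean
ergodicity on `ℓ^∞` is much more restrictive than on `c₀`.

* Some order bounded disjoint sequence does not tend to zero in norm. A subsequence spans a copy of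
  `ℓ^∞` (`exists_retract_boundedSequences`); this is where countable order completeness enters. The
  operator is a direct sum of symmetric stochastic `2 × 2` matrices with eigenvalues `1` and
  `l j`, where `l j → -1` (`exists_boundedSequence_operator`). As the `l j` stay away from `1`, the
  averages even converge in operator norm. On the eigenvectors of the `l j` the even powers act as
  multiplication by `l ^ (2 n)`, which tends to zero coordinatewise in `n`, but to `1` along the
  coordinates for each fixed `n`. So they have no weak cluster point.

* Every order bounded disjoint sequence is norm null. The increments of a norm bounded increasing
  sequence without limit can be replaced by a disjoint sequence
  (`exists_disjoint_of_norm_bounded`), which spans a copy of `c₀` (`exists_retract_nullFamilies`).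
  The operator `shiftFeedCLM` on `c₀` carries the first unit vector `e` along a line; from the `k`-th
  site of the line a copy is sent into each of the rows `i ≤ k`, entering at position `k ^ 2` and
  moving towards the start of the row. At time `k ^ 2 + k + 1` all of these copies are at the
  starts of their rows, so that weak cluster points along these times would not be null families.
  The squares are sparse: at any time at most one of the copies meant for different `k` can reach a
  given coordinate, which gives power-boundedness, and these arrivals have density zero, which
  gives mean ergodicity.

The coordinate functionals that make up `Φ` come from the Hahn–Banach theorem
(`exists_positive_functional`), with a sublinear functional that sees only the band of the given
element, so that no band projections are needed.
-/

/-! ### Disjointness and positive functionals in Banach lattices -/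

section Lattice

lemma inf_eq_zero_of_le {E : Type*} [Lattice E] [Zero E] {x y a b : E} (ha : 0 ≤ a) (hb : 0 ≤ b)
    (hax : a ≤ x) (hby : b ≤ y) (h : x ⊓ y = 0) : a ⊓ b = 0 :=
  le_antisymm (h ▸ inf_le_inf hax hby) (le_inf ha hb)

lemma smul_inf_of_pos {E : Type*} [AddCommGroup E] [Lattice E] [Module ℝ E] [IsOrderedModule ℝ E]
    {c : ℝ} (hc : 0 < c) (x y : E) : c • (x ⊓ y) = c • x ⊓ c • y :=
  (OrderIso.smulRight hc).map_inf x y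

lemma abs_smul_le_abs_smul_abs {E : Type*} [AddCommGroup E] [Lattice E] [Module ℝ E]
    [IsOrderedModule ℝ E] (c : ℝ) (x : E) : |c • x| ≤ |c| • |x| := by
  have key : ∀ (d : ℝ) (y : E), 0 ≤ d → |d • y| ≤ d • |y| := fun d y hd => abs_le'.2
    ⟨smul_le_smul_of_nonneg_left (le_abs_self y) hd, by
      rw [← smul_neg]
      exact smul_le_smul_of_nonneg_left (neg_le_abs y) hd⟩
  rcases le_total 0 c with hc | hc
  · rw [abs_of_nonneg hc]
    exact key c x hc
  · rw [abs_of_nonpos hc, ← abs_neg, ← neg_smul]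
    exact key _ x (neg_nonneg.2 hc)

lemma posPart_smul_of_pos {E : Type*} [AddCommGroup E] [Lattice E] [Module ℝ E]
    [IsOrderedModule ℝ E] {c : ℝ} (hc : 0 < c) (x : E) : (c • x)⁺ = c • x⁺ := by
  have h : c • (x ⊔ 0) = c • x ⊔ c • (0 : E) := (OrderIso.smulRight (β := E) hc).map_sup x 0
  rw [posPart_def, posPart_def, h, smul_zero]

variable {E : Type*} [AddCommGroup E] [Lattice E] [IsOrderedAddMonoid E]

lemma add_inf_le_inf_add_inf {x y z : E} (hx : 0 ≤ x) (hy : 0 ≤ y) (hz : 0 ≤ z) :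
    (x + y) ⊓ z ≤ x ⊓ z + y ⊓ z := by
  rw [add_inf, inf_add, inf_add]
  refine le_inf (le_inf inf_le_left ?_) (le_inf ?_ ?_)
  · exact inf_le_right.trans (le_add_of_nonneg_right hy)
  · exact inf_le_right.trans (le_add_of_nonneg_left hx)
  · exact inf_le_right.trans (le_add_of_nonneg_right hz)

lemma posPart_add_le_posPart_add_posPart (x y : E) : (x + y)⁺ ≤ x⁺ + y⁺ :=
  sup_le (add_le_add (le_posPart x) (le_posPart y))
    (add_nonneg (posPart_nonneg x) (posPart_nonneg y))

lemma posPart_sub_inf_posPart_sub (x y : E) : (x - y)⁺ ⊓ (y - x)⁺ = 0 := by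
  rw [← neg_sub x y, posPart_neg, posPart_inf_negPart_eq_zero]

lemma abs_add_le_abs_add_abs (x y : E) : |x + y| ≤ |x| + |y| :=
  abs_le'.2 ⟨add_le_add (le_abs_self x) (le_abs_self y), by
    rw [neg_add]
    exact add_le_add (neg_le_abs x) (neg_le_abs y)⟩

lemma abs_sub_le_abs_add_abs (x y : E) : |x - y| ≤ |x| + |y| := by
  rw [sub_eq_add_neg, ← abs_neg y]
  exact abs_add_le_abs_add_abs x (-y)

lemma add_eq_sup_of_inf_eq_zero {x y : E} (h : x ⊓ y = 0) : x + y = x ⊔ y := by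
  rw [← inf_add_sup x y, h, zero_add]

lemma add_inf_eq_zero {x y z : E} (hx : x ⊓ z = 0) (hy : y ⊓ z = 0) : (x + y) ⊓ z = 0 := by
  have hx0 : 0 ≤ x := hx ▸ inf_le_left
  have hy0 : 0 ≤ y := hy ▸ inf_le_left
  have hz0 : 0 ≤ z := hy ▸ inf_le_right
  refine le_antisymm ?_ (le_inf (add_nonneg hx0 hy0) hz0)
  simpa [hx, hy] using add_inf_le_inf_add_inf hx0 hy0 hz0

lemma sum_inf_eq_zero {ι : Type*} {x : ι → E} {z : E} (hz : 0 ≤ z) (F : Finset ι)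
    (h : ∀ i ∈ F, x i ⊓ z = 0) : (∑ i ∈ F, x i) ⊓ z = 0 := by
  classical
  induction F using Finset.induction_on with
  | empty => simpa using hz
  | insert a F ha ih =>
    rw [Finset.sum_insert ha]
    exact add_inf_eq_zero (h a (Finset.mem_insert_self _ _))
      (ih fun i hi => h i (Finset.mem_insert_of_mem hi))

/-- The sum of finitely many pairwise disjoint positive elements is their supremum. -/
lemma sum_le_of_pairwise_inf_eq_zero {ι : Type*} {x : ι → E} {u : E}
    (hd : Pairwise fun i j => x i ⊓ x j = 0) (hu : 0 ≤ u) (hx0 : ∀ i, 0 ≤ x i)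
    (hx : ∀ i, x i ≤ u) (F : Finset ι) : ∑ i ∈ F, x i ≤ u := by
  classical
  induction F using Finset.induction_on with
  | empty => simpa using hu
  | insert a F ha ih =>
    rw [Finset.sum_insert ha, add_comm, add_eq_sup_of_inf_eq_zero]
    · exact sup_le ih (hx a)
    · exact sum_inf_eq_zero (hx0 a) F fun i hi => hd fun h => ha (h ▸ hi)

/-- Disjointness from a fixed element passes to suprema. -/
lemma isLUB_inf_eq_zero {A : Set E} {s z : E} (hs : IsLUB A s) (hA : A.Nonempty)
    (h : ∀ a ∈ A, a ⊓ z = 0) : s ⊓ z = 0 := by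
  obtain ⟨a₀, ha₀⟩ := hA
  have hz : 0 ≤ z := h a₀ ha₀ ▸ inf_le_right
  have hs0 : 0 ≤ s := (h a₀ ha₀ ▸ inf_le_left : 0 ≤ a₀).trans (hs.1 ha₀)
  have ht : 0 ≤ s ⊓ z := le_inf hs0 hz
  refine le_antisymm ?_ ht
  have : s ≤ s - s ⊓ z := hs.2 fun a ha => by
    have ha0 : 0 ≤ a := h a ha ▸ inf_le_left
    rw [le_sub_iff_add_le, add_eq_sup_of_inf_eq_zero
      (inf_eq_zero_of_le ha0 ht le_rfl inf_le_right (h a ha))]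
    exact sup_le (hs.1 ha) inf_le_left
  simpa using this

variable [Module ℝ E] [IsOrderedModule ℝ E]

lemma inf_smul_eq_zero {x z : E} (h : x ⊓ z = 0) {t : ℝ} (ht : 0 ≤ t) : x ⊓ t • z = 0 := by
  have hx0 : 0 ≤ x := h ▸ inf_le_left
  have hz0 : 0 ≤ z := h ▸ inf_le_right
  obtain ⟨n, hn⟩ := exists_nat_ge t
  have key : ((n : ℝ) • z) ⊓ x = 0 := by
    rw [Nat.cast_smul_eq_nsmul, ← Finset.card_range n, ← Finset.sum_const]
    exact sum_inf_eq_zero hx0 _ fun i _ => by rwa [inf_comm]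
  refine inf_eq_zero_of_le hx0 (smul_nonneg ht hz0) le_rfl
    (smul_le_smul_of_nonneg_right hn hz0) (by rwa [inf_comm])

end Lattice

section Normed
variable {E : Type*} [NormedAddCommGroup E] [Lattice E] [IsOrderedAddMonoid E] [HasSolidNorm E]

lemma norm_le_norm_of_nonneg_of_le {x y : E} (hx : 0 ≤ x) (hxy : x ≤ y) : ‖x‖ ≤ ‖y‖ :=
  norm_le_norm_of_abs_le_abs (by rwa [abs_of_nonneg hx, abs_of_nonneg (hx.trans hxy)])

lemma norm_posPart_le (x : E) : ‖x⁺‖ ≤ ‖x‖ :=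
  norm_le_norm_of_abs_le_abs (by
    rw [abs_of_nonneg (posPart_nonneg x)]
    exact sup_le (le_abs_self x) (abs_nonneg x))

variable [NormedSpace ℝ E] [IsOrderedModule ℝ E]

/-- A positive functional of norm at most one that attains the norm of `z` and lives on the band
generated by `z`: on positive `x` it is controlled by the norms of the truncations `x ⊓ t • z`. -/
lemma exists_positive_functional {z : E} (hz : 0 ≤ z) (hz0 : z ≠ 0) :
    ∃ g : E →L[ℝ] ℝ, (∀ x, 0 ≤ x → 0 ≤ g x) ∧ (∀ x, |g x| ≤ ‖x‖) ∧ g z = ‖z‖ ∧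
      ∀ x, 0 ≤ x → ∀ η : ℝ, 0 < η → ∃ t : ℝ, 0 ≤ t ∧ g x ≤ ‖x ⊓ t • z‖ + η := by
  -- Hahn–Banach for the sublinear functional `x ↦ sup_t ‖x⁺ ⊓ t z‖`.
  let p : E → ℝ := fun x => ⨆ t : NNReal, ‖x⁺ ⊓ (t : ℝ) • z‖
  have htz : ∀ t : NNReal, 0 ≤ (t : ℝ) • z := fun t => smul_nonneg t.2 hz
  have hin : ∀ (x : E) (t : NNReal), 0 ≤ x⁺ ⊓ (t : ℝ) • z :=
    fun x t => le_inf (posPart_nonneg x) (htz t)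
  have hle : ∀ (x : E) (t : NNReal), ‖x⁺ ⊓ (t : ℝ) • z‖ ≤ ‖x‖ := fun x t =>
    (norm_le_norm_of_nonneg_of_le (hin x t) inf_le_left).trans (norm_posPart_le x)
  have hbdd : ∀ x : E, BddAbove (Set.range fun t : NNReal => ‖x⁺ ⊓ (t : ℝ) • z‖) := fun x =>
    ⟨‖x‖, by rintro _ ⟨t, rfl⟩; exact hle x t⟩
  have hp_norm : ∀ x, p x ≤ ‖x‖ := fun x => ciSup_le (hle x)
  have hp_smul_le : ∀ c : ℝ, 0 < c → ∀ x, p (c • x) ≤ c * p x := fun c hc x => by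
    refine ciSup_le fun t => ?_
    have h1 : (c • x)⁺ ⊓ (t : ℝ) • z = c • (x⁺ ⊓ ((t / c.toNNReal : NNReal) : ℝ) • z) := by
      rw [smul_inf_of_pos hc, posPart_smul_of_pos hc, smul_smul]
      congr 2
      rw [NNReal.coe_div, Real.coe_toNNReal c hc.le]
      field_simp
    rw [h1, norm_smul, Real.norm_of_nonneg hc.le]
    exact mul_le_mul_of_nonneg_left (le_ciSup (hbdd x) _) hc.le
  have hp_smul : ∀ c : ℝ, 0 < c → ∀ x, p (c • x) = c * p x := fun c hc x => by
    refine le_antisymm (hp_smul_le c hc x) ?_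
    have := hp_smul_le c⁻¹ (inv_pos.2 hc) (c • x)
    rw [smul_smul, inv_mul_cancel₀ hc.ne', one_smul] at this
    calc c * p x ≤ c * (c⁻¹ * p (c • x)) := mul_le_mul_of_nonneg_left this hc.le
      _ = p (c • x) := by field_simp
  have hp_add : ∀ x y, p (x + y) ≤ p x + p y := fun x y => by
    refine ciSup_le fun t => ?_
    calc ‖(x + y)⁺ ⊓ (t : ℝ) • z‖ ≤ ‖x⁺ ⊓ (t : ℝ) • z + y⁺ ⊓ (t : ℝ) • z‖ := by
          refine norm_le_norm_of_nonneg_of_le (hin _ t) ?_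
          exact (inf_le_inf_right _ (posPart_add_le_posPart_add_posPart x y)).trans
            (add_inf_le_inf_add_inf (posPart_nonneg x) (posPart_nonneg y) (htz t))
      _ ≤ _ := norm_add_le _ _
      _ ≤ p x + p y := add_le_add (le_ciSup (hbdd x) t) (le_ciSup (hbdd y) t)
  have hp_neg : ∀ x, 0 ≤ x → p (-x) ≤ 0 := fun x hx => by
    refine ciSup_le fun t => ?_
    have : (-x)⁺ = 0 := by simpa using hx
    rw [this, inf_eq_left.2 (htz t), norm_zero]
  have hp0 : ∀ x, 0 ≤ p x := fun x => Real.iSup_nonneg fun t => norm_nonneg _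
  have hpz : ‖z‖ ≤ p z := by
    have h : ‖z⁺ ⊓ ((1 : NNReal) : ℝ) • z‖ ≤ p z := le_ciSup (hbdd z) 1
    rwa [posPart_eq_self.2 hz, NNReal.coe_one, one_smul, inf_idem] at h
  let f : E →ₗ.[ℝ] ℝ := LinearPMap.mkSpanSingleton z ‖z‖ hz0
  obtain ⟨g, hg1, hg2⟩ := exists_extension_of_le_sublinear
    f p hp_smul hp_add (by
      rintro ⟨x, hx⟩
      obtain ⟨c, rfl⟩ := Submodule.mem_span_singleton.1 hx
      have : f ⟨c • z, hx⟩ = c * ‖z‖ :=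
        LinearPMap.mkSpanSingleton'_apply _ _ _ _ _
      rw [this]
      rcases le_or_gt c 0 with hc | hc
      · exact (mul_nonpos_of_nonpos_of_nonneg hc (norm_nonneg _)).trans (hp0 _)
      · change c * ‖z‖ ≤ p (c • z)
        rw [hp_smul c hc]
        exact mul_le_mul_of_nonneg_left hpz hc.le)
  have habs : ∀ x, |g x| ≤ ‖x‖ := fun x => abs_le.2
    ⟨by
      have := (hg2 (-x)).trans (hp_norm (-x))
      rw [map_neg, norm_neg] at this
      linarith, (hg2 x).trans (hp_norm x)⟩
  refine ⟨g.mkContinuous 1 fun x => by simpa using habs x, fun x hx => ?_, habs, ?_, ?_⟩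
  · have := (hg2 (-x)).trans (hp_neg x hx)
    rw [map_neg] at this
    simpa using this
  · have h := hg1 ⟨z, Submodule.mem_span_singleton_self (R := ℝ) z⟩
    have h' : f ⟨z, Submodule.mem_span_singleton_self (R := ℝ) z⟩ = ‖z‖ :=
      LinearPMap.mkSpanSingleton'_apply_self _ _ _ _
    exact h.trans h'
  · intro x hx η hη
    obtain ⟨t, ht⟩ := exists_lt_of_lt_ciSup (show p x - η < p x by linarith)
    refine ⟨t, t.2, ?_⟩
    rw [posPart_eq_self.2 hx] at ht
    have := hg2 x
    change g x ≤ _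
    linarith

end Normed

/-! ### Disjoint sequences from norm bounded sums -/

/-- Rosenthal's disjointification lemma for nonnegative matrices with bounded row sums: some
infinite submatrix has small off-diagonal row sums. -/
lemma exists_injective_offDiag_sum_le {ε : ℝ} (hε : 0 < ε) (a : ℕ → ℕ → ℝ)
    (ha : ∀ n k, 0 ≤ a n k) {M : ℝ} (hM : ∀ n (F : Finset ℕ), ∑ k ∈ F, a n k ≤ M) :
    ∃ φ : ℕ → ℕ, Function.Injective φ ∧
      ∀ n (F : Finset ℕ), n ∉ F → ∑ k ∈ F, a (φ n) (φ k) ≤ ε := by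
  classical
  obtain ⟨j, hj⟩ := exists_nat_ge (M / ε)
  rw [div_le_iff₀ hε] at hj
  -- Induction on the number `j` of times that `ε` can be taken off the row bound `M`.
  induction j generalizing a M with
  | zero =>
    refine ⟨id, Function.injective_id, fun n F _ => (hM n F).trans ?_⟩
    simp only [Nat.cast_zero, zero_mul] at hj
    linarith
  | succ j ih =>
    -- The sets `{pair p m | m}` partition `ℕ` into infinitely many infinite sets.
    by_cases h : ∃ p, ∀ n (F : Finset ℕ), n ∉ F →
        ∑ k ∈ F, a (Nat.pair p n) (Nat.pair p k) ≤ ε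
    · obtain ⟨p, hp⟩ := h
      exact ⟨Nat.pair p, fun x y hxy => (Nat.pair_eq_pair.1 hxy).2, hp⟩
    · push Not at h
      choose n F hnF hF using h
      let ψ : ℕ → ℕ := fun p => Nat.pair p (n p)
      have hψ : Function.Injective ψ := fun x y hxy => (Nat.pair_eq_pair.1 hxy).1
      obtain ⟨φ, hφ, hφs⟩ := ih (fun p q => a (ψ p) (ψ q)) (fun _ _ => ha _ _)
        (M := M - ε) (fun p G => by
          have hdis : Disjoint (G.image ψ) ((F p).image (Nat.pair p)) := by
            rw [Finset.disjoint_left]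
            intro x hx hx'
            obtain ⟨q, -, rfl⟩ := Finset.mem_image.1 hx
            obtain ⟨k, hk, hkq⟩ := Finset.mem_image.1 hx'
            obtain ⟨rfl, h2⟩ := Nat.pair_eq_pair.1 hkq
            exact hnF p (h2 ▸ hk)
          have h1 := hM (ψ p) (G.image ψ ∪ (F p).image (Nat.pair p))
          rw [Finset.sum_union hdis, Finset.sum_image (fun x _ y _ h => hψ h),
            Finset.sum_image (fun x _ y _ h => (Nat.pair_eq_pair.1 h).2)] at h1
          have h2 := hF p
          change ∑ k ∈ G, a (ψ p) (ψ k) ≤ M - ε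
          change ε < ∑ k ∈ F p, a (ψ p) (Nat.pair p k) at h2
          linarith) (by push_cast at hj; linarith)
      exact ⟨ψ ∘ φ, hψ.comp hφ, hφs⟩

/-- In a normed lattice that is not a KB-space there are positive elements bounded away from zero
whose finite sums are norm bounded: the increments of a bounded increasing sequence. -/
lemma exists_increments_of_not_isKBSpace {E : Type*} [NormedAddCommGroup E] [Lattice E]
    [IsOrderedAddMonoid E] [HasSolidNorm E] [CompleteSpace E] (h : ¬ IsKBSpace E) :
    ∃ (y : ℕ → E) (M δ : ℝ), 0 < δ ∧ (∀ n, 0 ≤ y n) ∧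
      (∀ F : Finset ℕ, ‖∑ k ∈ F, y k‖ ≤ M) ∧ ∀ n, δ ≤ ‖y n‖ := by
  unfold IsKBSpace at h
  push Not at h
  obtain ⟨u, hu0, hmono, ⟨C, hC⟩, hnot⟩ := h
  have hnc : ¬ CauchySeq u := fun hc => (cauchySeq_tendsto_of_complete hc).elim hnot
  rw [Metric.cauchySeq_iff'] at hnc
  push Not at hnc
  obtain ⟨δ, hδ, hfar⟩ := hnc
  choose ψ hψ hψδ using hfar
  let φ : ℕ → ℕ := fun n => ψ^[n] 0
  have hφ : ∀ n, φ (n + 1) = ψ (φ n) := fun n => Function.iterate_succ_apply' ψ n 0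
  have hy0 : ∀ n, 0 ≤ u (φ (n + 1)) - u (φ n) := fun n =>
    sub_nonneg.2 (hmono (by rw [hφ]; exact hψ _))
  refine ⟨fun n => u (φ (n + 1)) - u (φ n), C, δ, hδ, hy0, fun F => ?_, fun n => ?_⟩
  · obtain ⟨N, hN⟩ := F.exists_nat_subset_range
    refine le_trans (norm_le_norm_of_nonneg_of_le (Finset.sum_nonneg fun n _ => hy0 n) ?_)
      (hC (φ N))
    refine (Finset.sum_le_sum_of_subset_of_nonneg hN fun n _ _ => hy0 n).trans ?_
    rw [Finset.sum_range_sub (fun n => u (φ n))]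
    exact sub_le_self _ (hu0 _)
  · rw [← dist_eq_norm, hφ]
    exact hψδ _

section DisjointSequences

variable {E : Type*} [NormedAddCommGroup E] [NormedSpace ℝ E] [Lattice E] [IsOrderedAddMonoid E]
  [IsOrderedModule ℝ E] [HasSolidNorm E]

/-- An order bounded sequence of positive elements that is bounded away from zero, but whose finite
sums are norm bounded, can be replaced by a disjoint one. -/
lemma exists_disjoint_of_order_bounded {v : ℕ → E} {u : E} {M δ : ℝ} (hδ : 0 < δ)
    (hv0 : ∀ n, 0 ≤ v n) (hvu : ∀ n, v n ≤ u) (hM : ∀ F : Finset ℕ, ‖∑ k ∈ F, v k‖ ≤ M)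
    (hvδ : ∀ n, δ ≤ ‖v n‖) :
    ∃ z : ℕ → E, (∀ n, 0 ≤ z n) ∧ (∀ n, z n ≤ u) ∧ (Pairwise fun i j => z i ⊓ z j = 0) ∧
      ∀ n, δ / 2 ≤ ‖z n‖ := by
  have hvne : ∀ n, v n ≠ 0 := fun n h => by
    have := hvδ n
    rw [h, norm_zero] at this
    linarith
  choose g hgpos hgle hgv _ using fun n => exists_positive_functional (hv0 n) (hvne n)
  have hu : 0 ≤ u := (hv0 0).trans (hvu 0)
  set α : ℝ := δ / (4 * (‖u‖ + 1)) with hα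
  have hu1 : 0 < ‖u‖ + 1 := by positivity
  have hα0 : 0 < α := by positivity
  have hαu : α * ‖u‖ ≤ δ / 4 := by
    have : α * (‖u‖ + 1) = δ / 4 := by rw [hα]; field_simp
    nlinarith
  obtain ⟨φ, -, hφs⟩ := exists_injective_offDiag_sum_le (ε := α * (δ / 4)) (by positivity)
    (fun n k => g n (v k)) (fun n k => hgpos n _ (hv0 k)) (M := M) (fun n F => by
      rw [← map_sum]
      exact (le_abs_self _).trans ((hgle n _).trans (hM F)))
  -- For `m < n`, `z m` lives where `α v n < v m`, and `z n` where `v m < α v n`.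
  let z : ℕ → E := fun n => (v (φ n) - α • u - α⁻¹ • ∑ m ∈ Finset.range n, v (φ m))⁺
  have hz0 : ∀ n, 0 ≤ z n := fun n => posPart_nonneg _
  have hS0 : ∀ n, 0 ≤ α⁻¹ • ∑ m ∈ Finset.range n, v (φ m) := fun n =>
    smul_nonneg (inv_nonneg.2 hα0.le) (Finset.sum_nonneg fun _ _ => hv0 _)
  have hαu0 : 0 ≤ α • u := smul_nonneg hα0.le hu
  have hdis : ∀ m n, m < n → z m ⊓ z n = 0 := fun m n hmn => by
    have h1 : z m ≤ (v (φ m) - α • v (φ n))⁺ := posPart_mono (by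
      rw [sub_sub]
      refine sub_le_sub_left ?_ _
      exact (smul_le_smul_of_nonneg_left (hvu _) hα0.le).trans (le_add_of_nonneg_right (hS0 m)))
    have h2 : z n ≤ α⁻¹ • (α • v (φ n) - v (φ m))⁺ := by
      rw [← posPart_smul_of_pos (inv_pos.2 hα0), smul_sub, smul_smul, inv_mul_cancel₀ hα0.ne',
        one_smul]
      refine posPart_mono ?_
      rw [sub_sub]
      refine sub_le_sub_left ?_ _
      refine le_trans (smul_le_smul_of_nonneg_left ?_ (inv_nonneg.2 hα0.le))
        (le_add_of_nonneg_left hαu0)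
      exact Finset.single_le_sum (f := fun m => v (φ m)) (fun _ _ => hv0 _)
        (Finset.mem_range.2 hmn)
    exact inf_eq_zero_of_le (hz0 m) (hz0 n) h1 h2
      (inf_smul_eq_zero (posPart_sub_inf_posPart_sub _ _) (inv_nonneg.2 hα0.le))
  refine ⟨z, hz0, fun n => ?_, fun m n hmn => ?_, fun n => ?_⟩
  · refine sup_le ?_ hu
    rw [sub_sub]
    exact (sub_le_self _ (add_nonneg hαu0 (hS0 n))).trans (hvu _)
  · rcases hmn.lt_or_gt with h | h
    · exact hdis m n h
    · rw [inf_comm]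
      exact hdis n m h
  · have h1 : g (φ n) (v (φ n) - α • u - α⁻¹ • ∑ m ∈ Finset.range n, v (φ m)) ≤ g (φ n) (z n) := by
      have := hgpos (φ n) _ (sub_nonneg.2 (le_posPart
        (v (φ n) - α • u - α⁻¹ • ∑ m ∈ Finset.range n, v (φ m))))
      rw [map_sub] at this
      exact sub_nonneg.1 this
    have h2 : g (φ n) (z n) ≤ ‖z n‖ := (le_abs_self _).trans (hgle _ _)
    have h3 : g (φ n) u ≤ ‖u‖ := (le_abs_self _).trans (hgle _ _)
    have h4 := hφs n (Finset.range n) (by simp)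
    simp only [map_sub, map_smul, map_sum, smul_eq_mul, hgv] at h1
    have h5 : α⁻¹ * ∑ m ∈ Finset.range n, g (φ n) (v (φ m)) ≤ δ / 4 := by
      rw [inv_mul_le_iff₀ hα0]
      exact h4
    have h6 := mul_le_mul_of_nonneg_left h3 hα0.le
    have h7 := hvδ (φ n)
    linarith

/-- If disjoint order bounded sequences are norm null, a sequence of positive elements that is
bounded away from zero, but whose finite sums are norm bounded, can be replaced by a disjoint
one. -/
lemma exists_disjoint_of_norm_bounded [CompleteSpace E]
    (hE : ∀ (u : E) (z : ℕ → E), (∀ n, 0 ≤ z n) → (∀ n, z n ≤ u) →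
      (Pairwise fun i j => z i ⊓ z j = 0) → Tendsto z atTop (𝓝 0))
    {y : ℕ → E} {M δ : ℝ} (hδ : 0 < δ) (hy0 : ∀ n, 0 ≤ y n)
    (hM : ∀ F : Finset ℕ, ‖∑ k ∈ F, y k‖ ≤ M) (hyδ : ∀ n, δ ≤ ‖y n‖) :
    ∃ z : ℕ → E, (∀ n, 0 ≤ z n) ∧ (Pairwise fun i j => z i ⊓ z j = 0) ∧
      (∀ F : Finset ℕ, ‖∑ k ∈ F, z k‖ ≤ M) ∧ ∀ n, δ / 2 ≤ ‖z n‖ := by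
  classical
  have hnull : ∀ u : E, 0 ≤ u → Tendsto (fun n => ‖u ⊓ y n‖) atTop (𝓝 0) := fun u hu => by
    by_contra hcon
    rw [Metric.tendsto_atTop] at hcon
    push Not at hcon
    obtain ⟨ε, hε, hfr⟩ := hcon
    obtain ⟨φ, hφ, hφε⟩ := extraction_of_frequently_atTop (frequently_atTop.2 hfr)
    have hin : ∀ n, 0 ≤ u ⊓ y (φ n) := fun n => le_inf hu (hy0 _)
    obtain ⟨z, hz0, hzu, hzd, hzn⟩ := exists_disjoint_of_order_bounded (u := u) (M := M)
      (v := fun n => u ⊓ y (φ n)) hε hin (fun n => inf_le_left) (fun F => by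
        calc ‖∑ k ∈ F, u ⊓ y (φ k)‖ ≤ ‖∑ k ∈ F, y (φ k)‖ :=
              norm_le_norm_of_nonneg_of_le (Finset.sum_nonneg fun k _ => hin k)
                (Finset.sum_le_sum fun k _ => inf_le_right)
          _ = ‖∑ k ∈ F.image φ, y k‖ := by
              rw [Finset.sum_image fun a _ b _ h => hφ.injective h]
          _ ≤ M := hM _)
      (fun n => by simpa using hφε n)
    have h0 := (hE u z hz0 hzu hzd).norm
    rw [norm_zero] at h0
    have := ge_of_tendsto' h0 hzn
    linarith
  obtain ⟨f, -, hf⟩ := exists_seq_of_forall_finset_exists (fun _ : ℕ × ℕ => True)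
    (fun a b => a.1 < b.1 ∧ a.2 < b.2 ∧ ‖y a.1 ⊓ y b.1‖ ≤ δ / 4 * (1 / 2) ^ b.2) (fun s _ => by
      let j := s.sup Prod.snd + 1
      have hev : ∀ᶠ b in atTop, ∀ x ∈ s, x.1 < b ∧ ‖y x.1 ⊓ y b‖ ≤ δ / 4 * (1 / 2) ^ j := by
        rw [Filter.eventually_all_finset]
        intro x _
        exact (eventually_gt_atTop _).and ((hnull _ (hy0 _)).eventually_le_const (by positivity))
      obtain ⟨b, hb⟩ := hev.exists
      exact ⟨(b, j), trivial, fun x hx =>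
        ⟨(hb x hx).1, Nat.lt_succ_of_le (Finset.le_sup (f := Prod.snd) hx), (hb x hx).2⟩⟩)
  let k : ℕ → ℕ := fun n => (f n).1
  have hk : StrictMono k := fun m n h => (hf m n h).1
  have hj : StrictMono fun n => (f n).2 := fun m n h => (hf m n h).2.1
  have hsmall : ∀ m n, m < n → ‖y (k m) ⊓ y (k n)‖ ≤ δ / 4 * (1 / 2) ^ n := fun m n h =>
    (hf m n h).2.2.trans (mul_le_mul_of_nonneg_left
      (pow_le_pow_of_le_one (by norm_num) (by norm_num) (hj.id_le n)) (by positivity))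
  let w : ℕ → ℕ → E := fun n m => if m = n then 0 else y (k n) ⊓ y (k m)
  have hw0 : ∀ n m, 0 ≤ w n m := fun n m => by
    dsimp only [w]
    split_ifs
    exacts [le_rfl, le_inf (hy0 _) (hy0 _)]
  have hw : ∀ n m, ‖w n m‖ ≤ δ / 4 * (1 / 2) ^ m := fun n m => by
    dsimp only [w]
    split_ifs with h
    · rw [norm_zero]
      positivity
    · rcases lt_or_gt_of_ne h with h | h
      · rw [inf_comm]
        exact (hsmall m n h).trans (mul_le_mul_of_nonneg_left
          (pow_le_pow_of_le_one (by norm_num) (by norm_num) h.le) (by positivity))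
      · exact hsmall n m h
  have hgeo := hasSum_geometric_two.mul_left (δ / 4)
  have hws : ∀ n, Summable (w n) := fun n => Summable.of_norm_bounded hgeo.summable (hw n)
  have hr : ∀ n, ‖∑' m, w n m‖ ≤ δ / 2 := fun n => by
    have := tsum_of_norm_bounded hgeo (hw n)
    linarith
  have hr0 : ∀ n, 0 ≤ ∑' m, w n m := fun n => tsum_nonneg (hw0 n)
  let z : ℕ → E := fun n => (y (k n) - ∑' m, w n m)⁺
  have hz0 : ∀ n, 0 ≤ z n := fun n => posPart_nonneg _
  have hzy : ∀ n, z n ≤ y (k n) := fun n => sup_le (sub_le_self _ (hr0 n)) (hy0 _)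
  have hzle : ∀ n m, m ≠ n → z n ≤ (y (k n) - y (k m))⁺ := fun n m h => by
    have h1 : w n m ≤ ∑' m, w n m := (hws n).le_tsum m fun j _ => hw0 n j
    have h2 : w n m = y (k n) ⊓ y (k m) := if_neg h
    refine sup_le ((sub_le_sub_left (h2 ▸ h1) _).trans ?_) (posPart_nonneg _)
    rw [sub_inf, sub_self, sup_comm]
    exact le_rfl
  refine ⟨z, hz0, fun i j hij => ?_, fun F => ?_, fun n => ?_⟩
  · exact inf_eq_zero_of_le (hz0 i) (hz0 j) (hzle i j hij.symm) (hzle j i hij)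
      (posPart_sub_inf_posPart_sub _ _)
  · calc ‖∑ i ∈ F, z i‖ ≤ ‖∑ i ∈ F, y (k i)‖ :=
          norm_le_norm_of_nonneg_of_le (Finset.sum_nonneg fun i _ => hz0 i)
            (Finset.sum_le_sum fun i _ => hzy i)
      _ = ‖∑ i ∈ F.image k, y i‖ := by
          rw [Finset.sum_image fun a _ b _ h => hk.injective h]
      _ ≤ M := hM _
  · have h1 : y (k n) ≤ z n + ∑' m, w n m := sub_le_iff_le_add.1 (le_posPart _)
    have h2 := (norm_le_norm_of_nonneg_of_le (hy0 _) h1).trans (norm_add_le _ _)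
    have h3 := hyδ (k n)
    have h4 := hr n
    linarith

end DisjointSequences

/-! ### Weak almost periodicity and complemented subspaces -/

section Ergodic
variable {E : Type*} [NormedAddCommGroup E] [NormedSpace ℝ E]

/-- Any subsequence of an orbit of a weakly almost periodic operator has a weak cluster point; by
Mazur's theorem it lies in each norm closed convex set that eventually contains the subsequence. -/
lemma IsWeaklyAlmostPeriodic.exists_mem_of_eventually_mem {T : E →L[ℝ] E}
    (hT : IsWeaklyAlmostPeriodic T) (x : E) (φ : ℕ → ℕ) :
    ∃ y, ∀ C : Set E, Convex ℝ C → IsClosed C → (∀ᶠ n in atTop, (T ^ φ n) x ∈ C) → y ∈ C := by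
  let u : ℕ → WeakSpace ℝ E := fun n => toWeakSpace ℝ E ((T ^ φ n) x)
  obtain ⟨y, -, hy⟩ := (hT x).exists_clusterPt (f := map u atTop) (by
    rw [le_principal_iff, mem_map]
    exact univ_mem' fun n => subset_closure ⟨_, ⟨φ n, rfl⟩, rfl⟩)
  refine ⟨(toWeakSpace ℝ E).symm y, fun C hC hCc hev => ?_⟩
  have hcl : closure (toWeakSpace ℝ E '' C) = toWeakSpace ℝ E '' C := by
    rw [← hC.toWeakSpace_closure ℝ, hCc.closure_eq]
  have hmem : y ∈ closure (toWeakSpace ℝ E '' C) := by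
    rw [mem_closure_iff_clusterPt]
    refine hy.mono ?_
    rw [le_principal_iff, mem_map]
    filter_upwards [hev] with n hn using ⟨_, hn, rfl⟩
  rw [hcl] at hmem
  obtain ⟨c, hc, rfl⟩ := hmem
  simpa using hc

lemma IsPowerBounded.of_forall_norm_le {T : E →L[ℝ] E} {C : ℝ} (hC : 0 ≤ C)
    (h : ∀ n x, ‖(T ^ n) x‖ ≤ C * ‖x‖) : IsPowerBounded T :=
  ⟨C, fun n => ContinuousLinearMap.opNorm_le_bound _ hC (h n)⟩

/-- For a power-bounded operator, convergence to zero of the Cesàro averages is stable under norm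
limits. -/
lemma tendsto_average_zero_of_approx {T : E →L[ℝ] E} (hT : IsPowerBounded T) {x : E}
    (h : ∀ ε : ℝ, 0 < ε → ∃ x', ‖x - x'‖ ≤ ε ∧
      Tendsto (fun n : ℕ => (n : ℝ)⁻¹ • ∑ k ∈ Finset.range n, (T ^ k) x') atTop (𝓝 0)) :
    Tendsto (fun n : ℕ => (n : ℝ)⁻¹ • ∑ k ∈ Finset.range n, (T ^ k) x) atTop (𝓝 0) := by
  obtain ⟨C, hC⟩ := hT
  have hC0 : 0 ≤ C := (norm_nonneg _).trans (hC 0)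
  have hbound : ∀ (n : ℕ) (b : E),
      ‖(n : ℝ)⁻¹ • ∑ k ∈ Finset.range n, (T ^ k) b‖ ≤ C * ‖b‖ := fun n b => by
    rw [norm_smul, norm_inv, Real.norm_natCast]
    have h1 : ‖∑ k ∈ Finset.range n, (T ^ k) b‖ ≤ n * (C * ‖b‖) := by
      refine (norm_sum_le _ _).trans ((Finset.sum_le_sum fun k _ =>
        (T ^ k).le_of_opNorm_le (hC k) b).trans (by simp))
    rcases Nat.eq_zero_or_pos n with rfl | hn
    · simpa using mul_nonneg hC0 (norm_nonneg b)
    · rw [inv_mul_le_iff₀ (by exact_mod_cast hn)]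
      exact h1
  rw [Metric.tendsto_atTop]
  intro ε hε
  obtain ⟨x', hx', hlim⟩ := h (ε / (2 * (C + 1))) (by positivity)
  obtain ⟨N, hN⟩ := Metric.tendsto_atTop.1 hlim (ε / 2) (by positivity)
  refine ⟨N, fun n hn => ?_⟩
  have h1 := hN n hn
  have h2 := hbound n (x - x')
  rw [dist_zero_right] at h1 ⊢
  simp only [map_sub, Finset.sum_sub_distrib, smul_sub] at h2
  have h3 : C * ‖x - x'‖ ≤ ε / 2 := by
    have : (C + 1) * (ε / (2 * (C + 1))) = ε / 2 := by field_simp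
    have h4 := mul_le_mul (by linarith : C ≤ C + 1) hx' (norm_nonneg _) (by positivity)
    linarith
  have h5 := norm_le_norm_add_norm_sub' ((n : ℝ)⁻¹ • ∑ k ∈ Finset.range n, (T ^ k) x)
    ((n : ℝ)⁻¹ • ∑ k ∈ Finset.range n, (T ^ k) x')
  linarith

/-- If `F` is a complemented copy in `E` and each power-bounded, mean ergodic, positive operator
on `E` is weakly almost periodic, then so is each power-bounded, mean ergodic operator on `F` that
induces a positive operator on `E`. -/
lemma isWeaklyAlmostPeriodic_of_retract [PartialOrder E] {F : Type*} [NormedAddCommGroup F]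
    [NormedSpace ℝ F]
    (hE : ∀ T : E →L[ℝ] E, IsPositiveOperator T → IsPowerBounded T → IsMeanErgodic T →
      IsWeaklyAlmostPeriodic T)
    (Φ : E →L[ℝ] F) (J : F →L[ℝ] E) (hΦJ : ∀ a, Φ (J a) = a) (D : F →L[ℝ] F)
    (hpos : ∀ x, 0 ≤ x → 0 ≤ J (D (Φ x))) (hpb : IsPowerBounded D) (hme : IsMeanErgodic D) :
    IsWeaklyAlmostPeriodic D := by
  let T : E →L[ℝ] E := J.comp (D.comp Φ)
  have hTJ : ∀ n a, (T ^ n) (J a) = J ((D ^ n) a) := fun n a => by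
    induction n with
    | zero => rfl
    | succ n ih =>
      rw [pow_succ', pow_succ', mul_apply_eq_comp, ih, mul_apply_eq_comp]
      change J (D (Φ (J _))) = _
      rw [hΦJ]
  have hTx : ∀ n x, (T ^ (n + 1)) x = J ((D ^ (n + 1)) (Φ x)) := fun n x => by
    rw [pow_succ, mul_apply_eq_comp]
    change (T ^ n) (J (D (Φ x))) = _
    rw [hTJ, pow_succ, mul_apply_eq_comp]
  have hTpb : IsPowerBounded T := by
    obtain ⟨C, hC⟩ := hpb
    have hC0 : 0 ≤ C := (norm_nonneg _).trans (hC 0)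
    refine IsPowerBounded.of_forall_norm_le (C := ‖J‖ * (C * ‖Φ‖) + 1) (by positivity) fun n x => ?_
    cases n with
    | zero =>
      have : 0 ≤ ‖J‖ * (C * ‖Φ‖) * ‖x‖ := by positivity
      simp only [pow_zero, one_apply_eq_self]
      linarith
    | succ n =>
      rw [hTx]
      calc ‖J ((D ^ (n + 1)) (Φ x))‖ ≤ ‖J‖ * (C * (‖Φ‖ * ‖x‖)) :=
            (J.le_opNorm _).trans (mul_le_mul_of_nonneg_left
              (((D ^ (n + 1)).le_of_opNorm_le (hC _) _).trans
                (mul_le_mul_of_nonneg_left (Φ.le_opNorm x) hC0)) (norm_nonneg _))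
        _ ≤ (‖J‖ * (C * ‖Φ‖) + 1) * ‖x‖ := by linarith [norm_nonneg x]
  have hTme : IsMeanErgodic T := fun x => by
    obtain ⟨y, hy⟩ := hme (Φ x)
    refine ⟨J y + (0 : ℝ) • (x - J (Φ x)), ?_⟩
    have hsum : ∀ n, ∑ k ∈ Finset.range (n + 1), (T ^ k) x =
        J (∑ k ∈ Finset.range (n + 1), (D ^ k) (Φ x)) + (x - J (Φ x)) := fun n => by
      induction n with
      | zero => simp
      | succ n ih =>
        rw [Finset.sum_range_succ, ih, Finset.sum_range_succ _ (n + 1), map_add, hTx]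
        abel
    refine (((J.continuous.tendsto y).comp hy).add
      (tendsto_inv_atTop_nhds_zero_nat.smul_const (x - J (Φ x)))).congr fun n => ?_
    cases n with
    | zero => simp
    | succ n => rw [hsum, smul_add, Function.comp_apply, map_smul]
  intro a
  have hK := ((hE T hpos hTpb hTme) (J a)).image (WeakSpace.map Φ).continuous
  refine hK.closure_of_subset ?_
  rintro _ ⟨_, ⟨n, rfl⟩, rfl⟩
  refine ⟨toWeakSpace ℝ E ((T ^ n) (J a)), subset_closure ⟨_, ⟨n, rfl⟩, rfl⟩, ?_⟩
  change toWeakSpace ℝ F (Φ ((T ^ n) (J a))) = toWeakSpace ℝ F ((D ^ n) a)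
  rw [hTJ, hΦJ]

end Ergodic

/-! ### An operator on bounded sequences -/

section BoundedSequences

open BoundedContinuousFunction

/-- On bounded sequences there is a positive, power-bounded, mean ergodic operator that is not
weakly almost periodic: a direct sum of symmetric stochastic `2 × 2` matrices on the pairs of
coordinates `2j, 2j + 1`, whose second eigenvalues tend to `-1`. -/
lemma exists_boundedSequence_operator :
    ∃ D : (ℕ →ᵇ ℝ) →L[ℝ] (ℕ →ᵇ ℝ), (∀ a, (∀ k, 0 ≤ a k) → ∀ k, 0 ≤ D a k) ∧
      IsPowerBounded D ∧ IsMeanErgodic D ∧ ¬ IsWeaklyAlmostPeriodic D := by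
  let σ : ℕ → ℕ := fun k => if Even k then k + 1 else k - 1
  have hσ : ∀ k, σ (σ k) = k := fun k => by dsimp only [σ]; grind
  have hσ2 : ∀ k, σ k / 2 = k / 2 := fun k => by dsimp only [σ]; grind
  let l : ℕ → ℝ := fun k => -1 + 1 / ((k / 2 : ℕ) + 1 : ℝ)
  have hlσ : ∀ k, l (σ k) = l k := fun k => by dsimp only [l]; rw [hσ2]
  have hl : ∀ k, -1 ≤ l k ∧ l k ≤ 0 := fun k => by
    have h0 : (0 : ℝ) < (k / 2 : ℕ) + 1 := by positivity
    have h1 : (1 : ℝ) / ((k / 2 : ℕ) + 1) ≤ 1 := by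
      rw [div_le_one h0]
      have : (0 : ℝ) ≤ (k / 2 : ℕ) := Nat.cast_nonneg _
      linarith
    have h2 : (0 : ℝ) < 1 / ((k / 2 : ℕ) + 1) := by positivity
    dsimp only [l]
    constructor <;> linarith
  have hlabs : ∀ k, |l k| ≤ 1 := fun k => abs_le.2 ⟨(hl k).1, by linarith [(hl k).2]⟩
  have hlpow : ∀ k n, |l k ^ n| ≤ 1 := fun k n => by
    rw [abs_pow]
    exact pow_le_one₀ (abs_nonneg _) (hlabs k)
  have hllim : Tendsto l atTop (𝓝 (-1)) := by
    have h1 : Tendsto (fun k : ℕ => k / 2) atTop atTop := Nat.tendsto_div_const_atTop (by norm_num)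
    have h2 := (tendsto_one_div_add_atTop_nhds_zero_nat (𝕜 := ℝ)).comp h1
    simpa [l, Function.comp_def] using h2.const_add (-1)
  have habs : ∀ (a : ℕ →ᵇ ℝ) k, |a k| ≤ ‖a‖ := fun a k => a.norm_coe_le_norm k
  have hbound : ∀ (a : ℕ →ᵇ ℝ) (n k : ℕ),
      |1 / 2 * ((a k + a (σ k)) + l k ^ n * (a k - a (σ k)))| ≤ 2 * ‖a‖ := fun a n k => by
    have h1 := abs_le.1 (habs a k)
    have h2 := abs_le.1 (habs a (σ k))
    have h3 : |l k ^ n * (a k - a (σ k))| ≤ 2 * ‖a‖ := by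
      rw [abs_mul]
      calc _ ≤ 1 * |a k - a (σ k)| := mul_le_mul_of_nonneg_right (hlpow k n) (abs_nonneg _)
        _ ≤ 2 * ‖a‖ := by rw [one_mul, abs_le]; constructor <;> linarith
    have h4 := abs_le.1 h3
    rw [abs_le]
    constructor <;> linarith
  let D : (ℕ →ᵇ ℝ) →L[ℝ] (ℕ →ᵇ ℝ) := LinearMap.mkContinuous
    { toFun := fun a => BoundedContinuousFunction.ofNormedAddCommGroupDiscrete
        (fun k => 1 / 2 * ((a k + a (σ k)) + l k ^ 1 * (a k - a (σ k)))) (2 * ‖a‖) (hbound a 1)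
      map_add' := fun a b => by ext k; simp; ring
      map_smul' := fun c a => by ext k; simp; ring } 2
    (fun a => (BoundedContinuousFunction.norm_le (by positivity)).2 (hbound a 1))
  have hD : ∀ a k, D a k = 1 / 2 * ((a k + a (σ k)) + l k * (a k - a (σ k))) := fun a k => by
    change 1 / 2 * ((a k + a (σ k)) + l k ^ 1 * (a k - a (σ k))) = _
    rw [pow_one]
  have hDn : ∀ n a k, (D ^ n) a k = 1 / 2 * ((a k + a (σ k)) + l k ^ n * (a k - a (σ k))) := by
    intro n
    induction n with
    | zero => intro a k; simp; ring
    | succ n ih =>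
      intro a k
      rw [pow_succ', mul_apply_eq_comp, hD, ih, ih, hσ, hlσ]
      ring
  refine ⟨D, fun a ha k => ?_, ?_, fun a => ?_, fun hw => ?_⟩
  · rw [hD]
    have h1 := mul_nonneg (ha k) (by linarith [(hl k).1] : 0 ≤ 1 + l k)
    have h2 := mul_nonneg (ha (σ k)) (by linarith [(hl k).2] : 0 ≤ 1 - l k)
    linarith
  · exact IsPowerBounded.of_forall_norm_le (C := 2) (by norm_num) fun n a =>
      (BoundedContinuousFunction.norm_le (by positivity)).2 fun k => by
        rw [Real.norm_eq_abs, hDn]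
        exact hbound a n k
  · let y : ℕ →ᵇ ℝ := BoundedContinuousFunction.ofNormedAddCommGroupDiscrete
      (fun k => 1 / 2 * (a k + a (σ k))) ‖a‖ fun k => by
        have h1 := abs_le.1 (habs a k)
        have h2 := abs_le.1 (habs a (σ k))
        rw [Real.norm_eq_abs, abs_le]
        constructor <;> linarith
    refine ⟨y, ?_⟩
    rw [tendsto_iff_norm_sub_tendsto_zero]
    have hlim : Tendsto (fun n : ℕ => (n : ℝ)⁻¹ * (2 * ‖a‖)) atTop (𝓝 0) := by
      simpa using tendsto_inv_atTop_nhds_zero_nat.mul_const (2 * ‖a‖)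
    refine squeeze_zero' (Eventually.of_forall fun n => norm_nonneg _) ?_ hlim
    filter_upwards [eventually_gt_atTop 0] with n hn
    have hn' : (n : ℝ) ≠ 0 := by positivity
    rw [BoundedContinuousFunction.norm_le (by positivity)]
    intro k
    have hsum : ((n : ℝ)⁻¹ • ∑ i ∈ Finset.range n, (D ^ i) a - y) k =
        (n : ℝ)⁻¹ * (1 / 2 * ((∑ i ∈ Finset.range n, l k ^ i) * (a k - a (σ k)))) := by
      have hy : y k = 1 / 2 * (a k + a (σ k)) := rfl
      rw [BoundedContinuousFunction.sub_apply, BoundedContinuousFunction.smul_apply,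
        BoundedContinuousFunction.sum_apply, hy]
      simp only [hDn]
      rw [← Finset.mul_sum, Finset.sum_add_distrib, ← Finset.sum_mul]
      simp only [Finset.sum_const, Finset.card_range, nsmul_eq_mul, smul_eq_mul]
      field_simp
      ring
    rw [hsum, Real.norm_eq_abs, abs_mul, abs_of_nonneg (by positivity : (0 : ℝ) ≤ (n : ℝ)⁻¹)]
    refine mul_le_mul_of_nonneg_left ?_ (by positivity)
    -- Geometric series: `1 - l k ≥ 1` bounds the partial sums by `2`.
    have hg : |∑ i ∈ Finset.range n, l k ^ i| ≤ 2 := by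
      have h1 := geom_sum_mul (l k) n
      have h2 : |∑ i ∈ Finset.range n, l k ^ i| * |l k - 1| ≤ 2 := by
        rw [← abs_mul, h1]
        have := abs_le.1 (hlpow k n)
        rw [abs_le]
        constructor <;> linarith
      have h3 : 1 ≤ |l k - 1| := by
        rw [le_abs]
        right
        linarith [(hl k).2]
      nlinarith [abs_nonneg (∑ i ∈ Finset.range n, l k ^ i)]
    have hd : |a k - a (σ k)| ≤ 2 * ‖a‖ := by
      have h1 := abs_le.1 (habs a k)
      have h2 := abs_le.1 (habs a (σ k))
      rw [abs_le]
      constructor <;> linarith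
    rw [abs_mul, abs_mul, abs_of_pos (by norm_num : (0 : ℝ) < 1 / 2)]
    have := mul_le_mul hg hd (abs_nonneg _) (by norm_num)
    linarith
  · -- The alternating sign sequence `e` satisfies `D ^ n e = l ^ n * e`. A weak cluster point of
    -- the even powers vanishes in each coordinate, yet is asymptotic to `e` along the coordinates.
    let e : ℕ →ᵇ ℝ := BoundedContinuousFunction.ofNormedAddCommGroupDiscrete
      (fun k => if Even k then 1 else -1) 1 fun k => by split_ifs <;> simp
    have he : ∀ k, e k = if Even k then 1 else -1 := fun k => rfl
    have heσ : ∀ k, e (σ k) = - e k := fun k => by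
      rw [he, he]
      dsimp only [σ]
      grind
    have hee : ∀ k, e k * e k = 1 := fun k => by rw [he]; split_ifs <;> norm_num
    have heabs : ∀ k, |e k| = 1 := fun k => by rw [he]; split_ifs <;> norm_num
    have hDe : ∀ n k, (D ^ n) e k = l k ^ n * e k := fun n k => by
      rw [hDn, heσ]
      ring
    obtain ⟨y, hy⟩ := hw.exists_mem_of_eventually_mem e fun n => 2 * n
    have hy0 : ∀ k, y k = 0 := fun k => by
      by_contra hne
      have hpos : 0 < |y k| := abs_pos.2 hne
      have hl1 : l k ^ 2 < 1 := by
        have h2 : (0 : ℝ) < 1 / ((k / 2 : ℕ) + 1) := by positivity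
        have h3 : l k = -1 + 1 / ((k / 2 : ℕ) + 1) := rfl
        nlinarith [(hl k).2]
      have hlim : Tendsto (fun n : ℕ => (l k ^ 2) ^ n) atTop (𝓝 0) :=
        tendsto_pow_atTop_nhds_zero_of_lt_one (sq_nonneg _) hl1
      have hmem := hy {a | a k ∈ Set.Icc (-(|y k| / 2)) (|y k| / 2)}
        ((convex_Icc (-(|y k| / 2)) (|y k| / 2)).is_linear_preimage
          ((BoundedContinuousFunction.evalCLM ℝ k).toLinearMap.isLinear))
        (isClosed_Icc.preimage (BoundedContinuousFunction.evalCLM ℝ k).continuous) (by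
          filter_upwards [hlim.eventually_le_const (by positivity : 0 < |y k| / 2)] with n hn
          change (D ^ (2 * n)) e k ∈ _
          rw [Set.mem_Icc, ← abs_le, hDe, abs_mul, heabs, mul_one, pow_mul,
            abs_of_nonneg (by positivity)]
          exact hn)
      have := abs_le.2 hmem
      linarith
    have hmem := hy {a | Tendsto (fun k => a k * e k) atTop (𝓝 1)} (by
        intro a ha b hb s t hs ht hst
        have := (Tendsto.const_mul s ha).add (Tendsto.const_mul t hb)
        rw [mul_one, mul_one, hst] at this
        refine this.congr fun k => ?_
        simp
        ring) (by
        refine isClosed_of_closure_subset fun a ha => ?_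
        change Tendsto _ _ _
        rw [Metric.tendsto_atTop]
        intro ε hε
        obtain ⟨b, hb, hab⟩ := Metric.mem_closure_iff.1 ha (ε / 2) (by positivity)
        obtain ⟨N, hN⟩ := Metric.tendsto_atTop.1 hb (ε / 2) (by positivity)
        refine ⟨N, fun k hk => ?_⟩
        have h1 := hN k hk
        have h2 : dist (a k * e k) (b k * e k) ≤ dist a b := by
          rw [Real.dist_eq, ← sub_mul, abs_mul, heabs, mul_one, ← Real.dist_eq]
          exact BoundedContinuousFunction.dist_coe_le_dist k
        have h3 := dist_triangle (a k * e k) (b k * e k) 1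
        linarith) (Eventually.of_forall fun n => by
        change Tendsto _ _ _
        have h1 : Tendsto (fun k => l k ^ (2 * n)) atTop (𝓝 1) := by
          have := hllim.pow (2 * n)
          rwa [pow_mul (-1 : ℝ), neg_one_sq, one_pow] at this
        refine h1.congr fun k => ?_
        rw [hDe, mul_assoc, hee, mul_one])
    have h0 : Tendsto (fun k => y k * e k) atTop (𝓝 0) := by simp [hy0]
    exact zero_ne_one (tendsto_nhds_unique h0 hmem)

end BoundedSequences

/-! ### Null families -/

section NullFamilies

open ZeroAtInfty

lemma tendsto_cofinite_zero_iff {ι : Type*} {f : ι → ℝ} :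
    Tendsto f cofinite (𝓝 0) ↔ ∀ ε : ℝ, 0 < ε → {i | ε ≤ |f i|}.Finite := by
  rw [Metric.tendsto_nhds]
  simp only [eventually_cofinite, dist_zero_right, Real.norm_eq_abs, not_lt]

variable {ι : Type*} [TopologicalSpace ι]

lemma ZeroAtInftyContinuousMap.abs_apply_le_norm (a : C₀(ι, ℝ)) (i : ι) : |a i| ≤ ‖a‖ :=
  a.toBCF.norm_coe_le_norm i

lemma ZeroAtInftyContinuousMap.norm_le_of_forall (a : C₀(ι, ℝ)) {C : ℝ} (hC : 0 ≤ C)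
    (h : ∀ i, |a i| ≤ C) : ‖a‖ ≤ C :=
  (BoundedContinuousFunction.norm_le (f := a.toBCF) hC).2 h

/-- Evaluation at `i`, as a continuous linear functional on `C₀(ι, ℝ)`. -/
noncomputable def evalNullFamily (i : ι) : C₀(ι, ℝ) →L[ℝ] ℝ :=
  LinearMap.mkContinuous
    { toFun := fun a => a i
      map_add' := fun _ _ => rfl
      map_smul' := fun _ _ => rfl } 1 fun a => by simpa using a.abs_apply_le_norm i

@[simp] lemma evalNullFamily_apply (i : ι) (a : C₀(ι, ℝ)) : evalNullFamily i a = a i := rfl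

variable [DiscreteTopology ι]

/-- A null family on a discrete index set, as an element of `C₀(ι, ℝ)`. -/
def nullFamily (f : ι → ℝ) (hf : ∀ ε : ℝ, 0 < ε → {i | ε ≤ |f i|}.Finite) : C₀(ι, ℝ) where
  toFun := f
  continuous_toFun := continuous_of_discreteTopology
  zero_at_infty' := by
    rw [cocompact_eq_cofinite]
    exact tendsto_cofinite_zero_iff.2 hf

@[simp] lemma nullFamily_apply (f : ι → ℝ) (hf : ∀ ε : ℝ, 0 < ε → {i | ε ≤ |f i|}.Finite)
    (i : ι) : nullFamily f hf i = f i := rfl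

lemma ZeroAtInftyContinuousMap.finite_le_abs (a : C₀(ι, ℝ)) {ε : ℝ} (hε : 0 < ε) :
    {i | ε ≤ |a i|}.Finite := by
  refine tendsto_cofinite_zero_iff.1 ?_ ε hε
  rw [← cocompact_eq_cofinite ι]
  exact a.zero_at_infty'

/-- The unit vector at `j`. -/
noncomputable def unitVector [DecidableEq ι] (j : ι) : C₀(ι, ℝ) :=
  nullFamily (fun i => if i = j then 1 else 0) fun ε hε =>
    (Set.finite_singleton j).subset fun i hi => by
      by_contra h
      have hij : i ≠ j := h
      simp only [Set.mem_ofPred_eq, if_neg hij, abs_zero] at hi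
      linarith

lemma unitVector_apply [DecidableEq ι] (j i : ι) :
    unitVector j i = if i = j then (1 : ℝ) else 0 := rfl

/-- The unit vectors span a dense subspace. -/
lemma exists_sum_unitVector_norm_sub_le [DecidableEq ι] (a : C₀(ι, ℝ)) {ε : ℝ} (hε : 0 < ε) :
    ∃ F : Finset ι, ‖a - ∑ j ∈ F, a j • unitVector j‖ ≤ ε := by
  refine ⟨(a.finite_le_abs hε).toFinset, ZeroAtInftyContinuousMap.norm_le_of_forall _ hε.le
    fun i => ?_⟩
  have h : (∑ j ∈ (a.finite_le_abs hε).toFinset, a j • unitVector j : C₀(ι, ℝ)) i =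
      if i ∈ (a.finite_le_abs hε).toFinset then a i else 0 := by
    rw [← evalNullFamily_apply, map_sum]
    simp [unitVector_apply]
  rw [ZeroAtInftyContinuousMap.sub_apply, h]
  split_ifs with hi
  · simpa using hε.le
  · rw [Set.Finite.mem_toFinset, Set.mem_ofPred_eq, not_le] at hi
    rw [sub_zero]
    exact hi.le

end NullFamilies

/-! ### An operator on null families -/

/-- The action on families indexed by `ℕ ⊕ ℕ × ℕ`: the first summand is shifted to the right, each
row `{i} × ℕ` of the second to the left, and the `k`-th entry of the first summand is added at
position `k ^ 2` of the rows `i ≤ k`. -/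
def shiftFeed (a : ℕ ⊕ ℕ × ℕ → ℝ) : ℕ ⊕ ℕ × ℕ → ℝ
  | .inl 0 => 0
  | .inl (k + 1) => a (.inl k)
  | .inr (i, p) => a (.inr (i, p + 1)) +
      if p = Nat.sqrt p * Nat.sqrt p ∧ i ≤ Nat.sqrt p then a (.inl (Nat.sqrt p)) else 0

/-- The finitely many coordinates that `shiftFeed` fills from a given one. -/
def shiftFeedTargets : ℕ ⊕ ℕ × ℕ → Set (ℕ ⊕ ℕ × ℕ)
  | .inl k => {.inl (k + 1)} ∪ (fun i => .inr (i, k * k)) '' Set.Iic k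
  | .inr (i, q) => {.inr (i, q - 1)}

lemma finite_shiftFeedTargets (j : ℕ ⊕ ℕ × ℕ) : (shiftFeedTargets j).Finite := by
  rcases j with k | ⟨i, q⟩
  · exact (Set.finite_singleton _).union ((Set.finite_Iic k).image _)
  · exact Set.finite_singleton _

lemma abs_shiftFeed_le {a : ℕ ⊕ ℕ × ℕ → ℝ} {C : ℝ} (ha : ∀ i, |a i| ≤ C) (j : ℕ ⊕ ℕ × ℕ) :
    |shiftFeed a j| ≤ 2 * C := by
  have hC : 0 ≤ C := (abs_nonneg _).trans (ha j)
  rcases j with (_ | k) | ⟨i, p⟩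
  · simpa [shiftFeed] using hC
  · exact (ha _).trans (by linarith)
  · refine (abs_add_le _ _).trans ?_
    have h1 := ha (.inr (i, p + 1))
    split_ifs
    · linarith [ha (.inl (Nat.sqrt p))]
    · rw [abs_zero]
      linarith

lemma shiftFeed_finite {a : ℕ ⊕ ℕ × ℕ → ℝ} (ha : ∀ ε : ℝ, 0 < ε → {i | ε ≤ |a i|}.Finite)
    (ε : ℝ) (hε : 0 < ε) : {j | ε ≤ |shiftFeed a j|}.Finite := by
  refine ((ha (ε / 2) (half_pos hε)).biUnion fun i _ => finite_shiftFeedTargets i).subset ?_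
  intro j hj
  rw [Set.mem_ofPred_eq] at hj
  rw [Set.mem_iUnion₂]
  rcases j with (_ | k) | ⟨i, p⟩
  · simp only [shiftFeed, abs_zero] at hj
    linarith
  · exact ⟨.inl k, (half_le_self hε.le).trans hj, Or.inl rfl⟩
  · by_cases h1 : ε / 2 ≤ |a (.inr (i, p + 1))|
    · exact ⟨.inr (i, p + 1), h1, rfl⟩
    · have h2 := hj.trans (abs_add_le _ _)
      split_ifs at h2 with h
      · refine ⟨.inl (Nat.sqrt p), ?_, Or.inr ⟨i, h.2, ?_⟩⟩
        · rw [Set.mem_ofPred_eq]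
          linarith
        · exact congrArg (fun q => Sum.inr (i, q)) h.1.symm
      · rw [abs_zero] at h2
        linarith

lemma sum_isSquare_Ico_le (p N : ℕ) :
    ∑ q ∈ Finset.Ico p (p + N), (if q = Nat.sqrt q * Nat.sqrt q then (1 : ℝ) else 0) ≤
      Nat.sqrt N + 2 := by
  rw [Finset.sum_boole]
  have hsub : (Finset.Ico p (p + N)).filter (fun q => q = Nat.sqrt q * Nat.sqrt q) ⊆
      (Finset.Ico (Nat.sqrt p) (Nat.sqrt p + (Nat.sqrt N + 2))).image fun r => r * r := by
    intro q hq
    rw [Finset.mem_filter, Finset.mem_Ico] at hq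
    obtain ⟨⟨hpq, hqN⟩, hsq⟩ := hq
    refine Finset.mem_image.2 ⟨Nat.sqrt q, Finset.mem_Ico.2 ⟨Nat.sqrt_le_sqrt hpq, ?_⟩, hsq.symm⟩
    have h1 := Nat.lt_succ_sqrt p
    have h2 := Nat.lt_succ_sqrt N
    by_contra hcon
    have h3 : Nat.sqrt p + (Nat.sqrt N + 2) ≤ Nat.sqrt q := not_lt.1 hcon
    have h4 := Nat.mul_le_mul h3 h3
    simp only [Nat.succ_eq_add_one] at h1 h2
    nlinarith
  have hcard := (Finset.card_le_card hsub).trans Finset.card_image_le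
  rw [Nat.card_Ico] at hcard
  have : (((Finset.Ico p (p + N)).filter (fun q => q = Nat.sqrt q * Nat.sqrt q)).card : ℝ) ≤
      ((Nat.sqrt p + (Nat.sqrt N + 2) - Nat.sqrt p : ℕ) : ℝ) := by exact_mod_cast hcard
  refine this.trans ?_
  rw [Nat.add_sub_cancel_left]
  push_cast
  exact le_rfl

section ShiftFeed

open ZeroAtInfty

/-- The operator on null families given by `shiftFeed`. -/
noncomputable def shiftFeedCLM : C₀(ℕ ⊕ ℕ × ℕ, ℝ) →L[ℝ] C₀(ℕ ⊕ ℕ × ℕ, ℝ) :=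
  LinearMap.mkContinuous
    { toFun := fun a => nullFamily (shiftFeed a) (shiftFeed_finite fun _ hε => a.finite_le_abs hε)
      map_add' := fun a b => by
        ext j
        rcases j with (_ | k) | ⟨i, p⟩
        · simp [shiftFeed]
        · simp [shiftFeed]
        · simp only [shiftFeed, nullFamily_apply, ZeroAtInftyContinuousMap.add_apply]
          split_ifs <;> ring
      map_smul' := fun c a => by
        ext j
        rcases j with (_ | k) | ⟨i, p⟩
        · simp [shiftFeed]
        · simp [shiftFeed]
        · simp only [shiftFeed, nullFamily_apply, ZeroAtInftyContinuousMap.smul_apply,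
            RingHom.id_apply, smul_eq_mul]
          split_ifs <;> ring } 2 fun a =>
    ZeroAtInftyContinuousMap.norm_le_of_forall _ (by positivity)
      (abs_shiftFeed_le a.abs_apply_le_norm)

local notation "D₀" => shiftFeedCLM

lemma shiftFeedCLM_inl_zero (a : C₀(ℕ ⊕ ℕ × ℕ, ℝ)) : D₀ a (.inl 0) = 0 := rfl

lemma shiftFeedCLM_inl_succ (a : C₀(ℕ ⊕ ℕ × ℕ, ℝ)) (k : ℕ) :
    D₀ a (.inl (k + 1)) = a (.inl k) := rfl

lemma shiftFeedCLM_inr (a : C₀(ℕ ⊕ ℕ × ℕ, ℝ)) (i p : ℕ) :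
    D₀ a (.inr (i, p)) = a (.inr (i, p + 1)) +
      if p = Nat.sqrt p * Nat.sqrt p ∧ i ≤ Nat.sqrt p then a (.inl (Nat.sqrt p)) else 0 := rfl

lemma shiftFeedCLM_nonneg {a : C₀(ℕ ⊕ ℕ × ℕ, ℝ)} (ha : ∀ j, 0 ≤ a j) (j : ℕ ⊕ ℕ × ℕ) :
    0 ≤ D₀ a j := by
  rcases j with (_ | k) | ⟨i, p⟩
  · exact le_rfl
  · exact ha _
  · rw [shiftFeedCLM_inr]
    refine add_nonneg (ha _) ?_
    split_ifs
    exacts [ha _, le_rfl]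

lemma shiftFeedCLM_pow_nonneg {a : C₀(ℕ ⊕ ℕ × ℕ, ℝ)} (ha : ∀ j, 0 ≤ a j) (n : ℕ)
    (j : ℕ ⊕ ℕ × ℕ) : 0 ≤ (D₀ ^ n) a j := by
  induction n generalizing j with
  | zero => exact ha j
  | succ n ih =>
    rw [pow_succ', mul_apply_eq_comp]
    exact shiftFeedCLM_nonneg ih j

lemma shiftFeedCLM_pow_inl (a : C₀(ℕ ⊕ ℕ × ℕ, ℝ)) (n k : ℕ) :
    (D₀ ^ n) a (.inl k) = if n ≤ k then a (.inl (k - n)) else 0 := by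
  induction n generalizing k with
  | zero => simp
  | succ n ih =>
    rw [pow_succ', mul_apply_eq_comp]
    cases k with
    | zero => simp [shiftFeedCLM_inl_zero]
    | succ k =>
      rw [shiftFeedCLM_inl_succ, ih]
      simp

/-- Away from the squares the rows are just shifted. -/
lemma shiftFeedCLM_pow_inr (a : C₀(ℕ ⊕ ℕ × ℕ, ℝ)) (i n p : ℕ)
    (hp : ∀ q, p ≤ q → q < p + n → q ≠ Nat.sqrt q * Nat.sqrt q) :
    (D₀ ^ n) a (.inr (i, p)) = a (.inr (i, p + n)) := by
  induction n generalizing p with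
  | zero => rfl
  | succ n ih =>
    rw [pow_succ', mul_apply_eq_comp, shiftFeedCLM_inr,
      if_neg fun h => hp p le_rfl (by omega) h.1, add_zero,
      ih _ fun q h1 h2 => hp q (by omega) (by omega)]
    congr 3
    omega

lemma ne_sqrt_mul_self_of_lt {k q : ℕ} (h1 : k * k < q) (h2 : q < (k + 1) * (k + 1)) :
    q ≠ Nat.sqrt q * Nat.sqrt q := by
  intro h
  rw [h] at h1 h2
  have := Nat.mul_self_lt_mul_self_iff.1 h1
  have := Nat.mul_self_lt_mul_self_iff.1 h2
  omega

/-- The `k`-th entry of the first summand is gone after `k` steps, before the next square comes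
up, so that no two of the entries fed into a row ever meet. -/
lemma abs_shiftFeedCLM_pow_le (a : C₀(ℕ ⊕ ℕ × ℕ, ℝ)) (n : ℕ) (j : ℕ ⊕ ℕ × ℕ) :
    |(D₀ ^ n) a j| ≤ 2 * ‖a‖ := by
  have hnn := norm_nonneg a
  rcases j with k | ⟨i, p⟩
  · rw [shiftFeedCLM_pow_inl]
    split_ifs
    · linarith [a.abs_apply_le_norm (.inl (k - n))]
    · rw [abs_zero]
      linarith
  · induction n generalizing p with
    | zero =>
      rw [pow_zero, one_apply_eq_self]
      linarith [a.abs_apply_le_norm (.inr (i, p))]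
    | succ n ih =>
      rw [pow_succ', mul_apply_eq_comp, shiftFeedCLM_inr]
      split_ifs with h
      · rw [shiftFeedCLM_pow_inl]
        split_ifs with hn
        · have hk := h.1
          set k := Nat.sqrt p with hkdef
          rw [shiftFeedCLM_pow_inr a i n (p + 1) fun q h1 h2 =>
            ne_sqrt_mul_self_of_lt (k := k) (by omega) (by nlinarith)]
          refine (abs_add_le _ _).trans ?_
          linarith [a.abs_apply_le_norm (.inr (i, p + 1 + n)), a.abs_apply_le_norm (.inl (k - n))]
        · rw [add_zero]
          exact ih _
      · rw [add_zero]
        exact ih _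

lemma isPowerBounded_shiftFeedCLM : IsPowerBounded D₀ :=
  IsPowerBounded.of_forall_norm_le (C := 2) (by norm_num) fun n a =>
    ZeroAtInftyContinuousMap.norm_le_of_forall _ (by positivity) (abs_shiftFeedCLM_pow_le a n)

lemma sum_shiftFeedCLM_pow_succ (a : C₀(ℕ ⊕ ℕ × ℕ, ℝ)) (N : ℕ) :
    ∑ n ∈ Finset.range (N + 1), (D₀ ^ n) a = D₀ (∑ n ∈ Finset.range N, (D₀ ^ n) a) + a := by
  rw [Finset.sum_range_succ', map_sum, pow_zero, one_apply_eq_self]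
  simp only [pow_succ', mul_apply_eq_comp]

/-- The sums of the orbit of a unit vector grow at most like the number of squares met. -/
lemma sum_shiftFeedCLM_pow_unitVector_le (j : ℕ ⊕ ℕ × ℕ) (N : ℕ) (m : ℕ ⊕ ℕ × ℕ) :
    (∑ n ∈ Finset.range N, (D₀ ^ n) (unitVector j)) m ≤ Nat.sqrt N + 3 := by
  have hinl : ∀ N k, (∑ n ∈ Finset.range N, (D₀ ^ n) (unitVector j)) (.inl k) ≤
      ∑ l ∈ Finset.range (k + 1), unitVector j (.inl l) := fun N => by
    induction N with
    | zero =>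
      intro k
      refine Finset.sum_nonneg fun l _ => ?_
      rw [unitVector_apply]
      split_ifs <;> norm_num
    | succ N ih =>
      intro k
      rw [sum_shiftFeedCLM_pow_succ, ZeroAtInftyContinuousMap.add_apply, Finset.sum_range_succ]
      refine add_le_add ?_ le_rfl
      cases k with
      | zero => rw [shiftFeedCLM_inl_zero, Finset.sum_range_zero]
      | succ k => exact ih k
  have hinl1 : ∀ N k, (∑ n ∈ Finset.range N, (D₀ ^ n) (unitVector j)) (.inl k) ≤ 1 := fun N k => by
    refine (hinl N k).trans ?_
    rcases j with j | j
    · simp only [unitVector_apply, Sum.inl.injEq, Finset.sum_ite_eq']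
      split_ifs <;> norm_num
    · simp [unitVector_apply]
  have hinr : ∀ N i p, (∑ n ∈ Finset.range N, (D₀ ^ n) (unitVector j)) (.inr (i, p)) ≤
      ∑ q ∈ Finset.Ico p (p + N), (unitVector j (.inr (i, q)) +
        if q = Nat.sqrt q * Nat.sqrt q then (1 : ℝ) else 0) := fun N => by
    induction N with
    | zero => intro i p; simp
    | succ N ih =>
      intro i p
      rw [sum_shiftFeedCLM_pow_succ, ZeroAtInftyContinuousMap.add_apply, shiftFeedCLM_inr,
        Finset.sum_eq_sum_Ico_succ_bot (by omega)]
      have h1 := ih i (p + 1)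
      rw [show p + 1 + N = p + (N + 1) by ring] at h1
      have h2 := hinl1 N (Nat.sqrt p)
      by_cases hp : p = Nat.sqrt p * Nat.sqrt p
      · rw [if_pos hp]
        split_ifs <;> linarith
      · rw [if_neg hp, if_neg fun h => hp h.1]
        linarith
  have hs : (0 : ℝ) ≤ Nat.sqrt N := Nat.cast_nonneg _
  rcases m with k | ⟨i, p⟩
  · linarith [hinl1 N k]
  · have h1 := hinr N i p
    rw [Finset.sum_add_distrib] at h1
    have h2 := sum_isSquare_Ico_le p N
    have h3 : ∑ q ∈ Finset.Ico p (p + N), (unitVector j (.inr (i, q)) : ℝ) ≤ 1 := by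
      rcases j with j | ⟨i', q'⟩
      · simp [unitVector_apply]
      · by_cases hi : i = i'
        · simp only [unitVector_apply, Sum.inr.injEq, Prod.mk.injEq, hi, true_and,
            Finset.sum_ite_eq']
          split_ifs <;> norm_num
        · simp [unitVector_apply, hi]
    linarith

lemma tendsto_average_shiftFeedCLM (a : C₀(ℕ ⊕ ℕ × ℕ, ℝ)) :
    Tendsto (fun N : ℕ => (N : ℝ)⁻¹ • ∑ n ∈ Finset.range N, (D₀ ^ n) a) atTop (𝓝 0) := by
  have hunit : ∀ j, Tendsto (fun N : ℕ => (N : ℝ)⁻¹ • ∑ n ∈ Finset.range N,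
      (D₀ ^ n) (unitVector j)) atTop (𝓝 0) := fun j => by
    have hlim : Tendsto (fun N : ℕ => (Real.sqrt N)⁻¹ + 3 * (N : ℝ)⁻¹) atTop (𝓝 0) := by
      have h1 : Tendsto (fun N : ℕ => (Real.sqrt N)⁻¹) atTop (𝓝 0) :=
        tendsto_inv_atTop_zero.comp (Real.tendsto_sqrt_atTop.comp tendsto_natCast_atTop_atTop)
      simpa using h1.add (tendsto_inv_atTop_nhds_zero_nat.const_mul 3)
    refine squeeze_zero_norm (fun N => ?_) hlim
    rw [norm_smul, norm_inv, Real.norm_natCast]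
    have h1 : ‖∑ n ∈ Finset.range N, (D₀ ^ n) (unitVector j)‖ ≤ Real.sqrt N + 3 := by
      refine ZeroAtInftyContinuousMap.norm_le_of_forall _ (by positivity) fun m => ?_
      rw [abs_of_nonneg]
      · refine (sum_shiftFeedCLM_pow_unitVector_le j N m).trans ?_
        gcongr
        exact Real.nat_sqrt_le_real_sqrt
      · rw [← evalNullFamily_apply, map_sum]
        refine Finset.sum_nonneg fun n _ => shiftFeedCLM_pow_nonneg (fun i => ?_) n m
        rw [unitVector_apply]
        split_ifs <;> norm_num
    refine (mul_le_mul_of_nonneg_left h1 (by positivity)).trans (le_of_eq ?_)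
    rw [mul_add, mul_comm (N : ℝ)⁻¹ 3, ← div_eq_inv_mul, Real.sqrt_div_self]
  refine tendsto_average_zero_of_approx isPowerBounded_shiftFeedCLM fun ε hε => ?_
  obtain ⟨F, hF⟩ := exists_sum_unitVector_norm_sub_le a hε
  refine ⟨_, hF, ?_⟩
  have hcomb : Tendsto (fun N : ℕ => ∑ j ∈ F, a j • ((N : ℝ)⁻¹ • ∑ n ∈ Finset.range N,
      (D₀ ^ n) (unitVector j))) atTop (𝓝 0) := by
    have := tendsto_finsetSum F fun j _ => (hunit j).const_smul (a j)
    simpa using this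
  refine hcomb.congr fun N => ?_
  simp only [map_sum, map_smul]
  rw [Finset.sum_comm, Finset.smul_sum]
  refine Finset.sum_congr rfl fun j _ => ?_
  rw [← Finset.smul_sum, smul_comm]

/-- At time `k ^ 2 + k + 1` the orbit of the first unit vector is at least one at the start of each
of the rows `i ≤ k`. -/
lemma one_le_shiftFeedCLM_pow_unitVector {i k : ℕ} (hik : i ≤ k) :
    1 ≤ (D₀ ^ (k * k + k + 1)) (unitVector (.inl 0)) (.inr (i, 0)) := by
  have hnn : ∀ m, (0 : ℝ) ≤ unitVector (.inl 0 : ℕ ⊕ ℕ × ℕ) m := fun m => by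
    rw [unitVector_apply]
    split_ifs <;> norm_num
  have key : ∀ m, m ≤ k * k →
      1 ≤ (D₀ ^ (m + k + 1)) (unitVector (.inl 0)) (.inr (i, k * k - m)) := fun m => by
    induction m with
    | zero =>
      intro _
      rw [pow_succ', mul_apply_eq_comp, shiftFeedCLM_inr, Nat.sub_zero, Nat.sqrt_eq,
        if_pos ⟨rfl, hik⟩, shiftFeedCLM_pow_inl, if_pos (by omega), Nat.zero_add, Nat.sub_self]
      have h1 : (unitVector (.inl 0) : C₀(ℕ ⊕ ℕ × ℕ, ℝ)) (.inl 0) = 1 := by simp [unitVector_apply]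
      rw [h1]
      linarith [shiftFeedCLM_pow_nonneg hnn k (.inr (i, k * k + 1))]
    | succ m ih =>
      intro hm
      have h1 := ih (by omega)
      rw [show m + 1 + k + 1 = m + k + 1 + 1 by ring, pow_succ', mul_apply_eq_comp,
        shiftFeedCLM_inr, show k * k - (m + 1) + 1 = k * k - m by omega]
      refine h1.trans (le_add_of_nonneg_right ?_)
      split_ifs
      exacts [shiftFeedCLM_pow_nonneg hnn _ _, le_rfl]
  simpa using key (k * k) le_rfl

lemma not_isWeaklyAlmostPeriodic_shiftFeedCLM : ¬ IsWeaklyAlmostPeriodic D₀ := by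
  intro hw
  obtain ⟨y, hy⟩ := hw.exists_mem_of_eventually_mem (unitVector (.inl 0))
    fun k => k * k + k + 1
  have h1 : ∀ i, 1 ≤ y (.inr (i, 0)) := fun i =>
    hy {a | a (.inr (i, 0)) ∈ Set.Ici (1 : ℝ)}
      ((convex_Ici (1 : ℝ)).is_linear_preimage
        (evalNullFamily (.inr (i, 0) : ℕ ⊕ ℕ × ℕ)).toLinearMap.isLinear)
      (isClosed_Ici.preimage (evalNullFamily (.inr (i, 0) : ℕ ⊕ ℕ × ℕ)).continuous) (by
        filter_upwards [eventually_ge_atTop i] with k hk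
        exact one_le_shiftFeedCLM_pow_unitVector hk)
  have hfin := y.finite_le_abs one_pos
  refine Set.infinite_of_injective_forall_mem (f := fun i : ℕ => (Sum.inr (i, 0) : ℕ ⊕ ℕ × ℕ))
    (fun i i' h => by simpa using h) (fun i => ?_) hfin
  exact (h1 i).trans (le_abs_self _)

end ShiftFeed

/-! ### Positively complemented copies of sequence spaces -/

section Embeddings

variable {E : Type*} [NormedAddCommGroup E] [NormedSpace ℝ E] [Lattice E] [IsOrderedAddMonoid E]
  [IsOrderedModule ℝ E] [HasSolidNorm E]

lemma abs_apply_le_apply_abs {E : Type*} [NormedAddCommGroup E] [NormedSpace ℝ E] [Lattice E]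
    [IsOrderedAddMonoid E] {h : E →L[ℝ] ℝ} (hpos : ∀ x, 0 ≤ x → 0 ≤ h x) (x : E) :
    |h x| ≤ h |x| := by
  have h1 := hpos _ (sub_nonneg.2 (le_abs_self x))
  have h2 := hpos _ (sub_nonneg.2 (neg_le_abs x))
  rw [map_sub] at h1 h2
  rw [map_neg] at h2
  exact abs_le.2 ⟨by linarith, by linarith⟩

/-- Positive functionals normalized at the members of a family that is bounded away from zero. Each
vanishes on the elements disjoint from its member, so they are biorthogonal to a disjoint family. -/
lemma exists_coordinate_functionals {ι : Type*} {z : ι → E} {δ : ℝ} (hδ : 0 < δ)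
    (hz0 : ∀ i, 0 ≤ z i) (hzδ : ∀ i, δ ≤ ‖z i‖) :
    ∃ h : ι → E →L[ℝ] ℝ, (∀ i x, 0 ≤ x → 0 ≤ h i x) ∧ (∀ i x, |h i x| ≤ δ⁻¹ * ‖x‖) ∧
      (∀ i, h i (z i) = 1) ∧ (∀ i x, x ⊓ z i = 0 → h i x = 0) ∧
      ∀ i x, 0 ≤ x → ∀ η : ℝ, 0 < η → ∃ t : ℝ, 0 ≤ t ∧ h i x ≤ δ⁻¹ * ‖x ⊓ t • z i‖ + η := by
  have hn : ∀ i, 0 < ‖z i‖ := fun i => hδ.trans_le (hzδ i)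
  have hinv : ∀ i, ‖z i‖⁻¹ ≤ δ⁻¹ := fun i => inv_anti₀ hδ (hzδ i)
  choose g hgpos hgle hgz hgt using fun i => exists_positive_functional (hz0 i)
    (norm_pos_iff.1 (hn i))
  have htr : ∀ i x, 0 ≤ x → ∀ η : ℝ, 0 < η →
      ∃ t : ℝ, 0 ≤ t ∧ (‖z i‖⁻¹ • g i) x ≤ δ⁻¹ * ‖x ⊓ t • z i‖ + η := fun i x hx η hη => by
    obtain ⟨t, ht, hgx⟩ := hgt i x hx (‖z i‖ * η) (mul_pos (hn i) hη)
    refine ⟨t, ht, ?_⟩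
    have h1 := mul_le_mul_of_nonneg_left hgx (inv_nonneg.2 (hn i).le)
    rw [mul_add, inv_mul_cancel_left₀ (hn i).ne'] at h1
    exact h1.trans (by gcongr; exact hzδ i)
  have hpos : ∀ i x, 0 ≤ x → 0 ≤ (‖z i‖⁻¹ • g i) x := fun i x hx =>
    mul_nonneg (inv_nonneg.2 (hn i).le) (hgpos i x hx)
  refine ⟨fun i => ‖z i‖⁻¹ • g i, hpos, fun i x => ?_, fun i => ?_, fun i x hx => ?_, htr⟩
  · change |‖z i‖⁻¹ * g i x| ≤ _
    rw [abs_mul, abs_of_pos (inv_pos.2 (hn i))]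
    exact mul_le_mul (hinv i) (hgle i x) (abs_nonneg _) (inv_nonneg.2 hδ.le)
  · change ‖z i‖⁻¹ * g i (z i) = 1
    rw [hgz, inv_mul_cancel₀ (hn i).ne']
  · have hx0 : 0 ≤ x := hx ▸ inf_le_left
    refine le_antisymm (le_of_forall_pos_le_add fun η hη => ?_) (hpos i x hx0)
    obtain ⟨t, ht, h1⟩ := htr i x hx0 η hη
    rwa [inf_smul_eq_zero hx ht, norm_zero, mul_zero] at h1

section NullFamilies

open ZeroAtInfty

/-- If order bounded disjoint sequences are norm null, a disjoint family bounded away from zero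
with norm bounded finite sums spans a positively complemented copy of the null families. -/
lemma exists_retract_nullFamilies [CompleteSpace E] {ι : Type*} [TopologicalSpace ι]
    [DiscreteTopology ι]
    (hE : ∀ (u : E) (z : ℕ → E), (∀ n, 0 ≤ z n) → (∀ n, z n ≤ u) →
      (Pairwise fun i j => z i ⊓ z j = 0) → Tendsto z atTop (𝓝 0))
    {z : ι → E} {M δ : ℝ} (hδ : 0 < δ) (hz0 : ∀ i, 0 ≤ z i)
    (hd : Pairwise fun i j => z i ⊓ z j = 0) (hM : ∀ F : Finset ι, ‖∑ i ∈ F, z i‖ ≤ M)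
    (hzδ : ∀ i, δ ≤ ‖z i‖) :
    ∃ (Φ : E →L[ℝ] C₀(ι, ℝ)) (J : C₀(ι, ℝ) →L[ℝ] E), (∀ a, Φ (J a) = a) ∧
      (∀ x, 0 ≤ x → ∀ i, 0 ≤ Φ x i) ∧ ∀ a : C₀(ι, ℝ), (∀ i, 0 ≤ a i) → 0 ≤ J a := by
  obtain ⟨h, hpos, hle, hzz, hdis, htr⟩ := exists_coordinate_functionals hδ hz0 hzδ
  have hfin : ∀ x, ∀ ε : ℝ, 0 < ε → {i | ε ≤ |h i x|}.Finite := fun x ε hε => by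
    by_contra hinf
    let i : ℕ ↪ {i | ε ≤ |h i x|} := Set.Infinite.natEmbedding _ hinf
    choose t ht htx using fun n => htr (i n) |x| (abs_nonneg x) (ε / 2) (half_pos hε)
    have hnull := (hE |x| (fun n => |x| ⊓ t n • z (i n))
      (fun n => le_inf (abs_nonneg x) (smul_nonneg (ht n) (hz0 _))) (fun n => inf_le_left)
      fun m n hmn => by
        have hmn' : (i m : ι) ≠ i n := fun h' => hmn (i.injective (Subtype.ext h'))
        refine inf_eq_zero_of_le (le_inf (abs_nonneg x) (smul_nonneg (ht m) (hz0 _)))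
          (le_inf (abs_nonneg x) (smul_nonneg (ht n) (hz0 _))) inf_le_right inf_le_right ?_
        refine inf_smul_eq_zero ?_ (ht n)
        rw [inf_comm]
        refine inf_smul_eq_zero ?_ (ht m)
        exact hd hmn'.symm).norm.const_mul δ⁻¹
    rw [norm_zero, mul_zero] at hnull
    have hge : ε / 2 ≤ 0 := ge_of_tendsto' hnull fun n => by
      have h1 : ε ≤ |h (i n) x| := (i n).2
      have h2 := abs_apply_le_apply_abs (hpos (i n)) x
      have h3 := htx n
      linarith
    linarith
  have hsumle : ∀ (a : ι → ℝ) (F : Finset ι) (c : ℝ), 0 ≤ c → (∀ i ∈ F, |a i| ≤ c) →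
      ‖∑ i ∈ F, a i • z i‖ ≤ c * M := fun a F c hc ha => by
    calc ‖∑ i ∈ F, a i • z i‖ ≤ ‖c • ∑ i ∈ F, z i‖ := by
          refine norm_le_norm_of_abs_le_abs ?_
          rw [abs_of_nonneg (smul_nonneg hc (Finset.sum_nonneg fun i _ => hz0 i)), abs_le',
            ← Finset.sum_neg_distrib, Finset.smul_sum]
          constructor
          · exact Finset.sum_le_sum fun i hi =>
              smul_le_smul_of_nonneg_right (abs_le.1 (ha i hi)).2 (hz0 i)
          · refine Finset.sum_le_sum fun i hi => ?_
            rw [← neg_smul]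
            exact smul_le_smul_of_nonneg_right (by linarith [(abs_le.1 (ha i hi)).1]) (hz0 i)
      _ ≤ c * M := by
          rw [norm_smul, Real.norm_of_nonneg hc]
          exact mul_le_mul_of_nonneg_left (hM F) hc
  have hM0 : 0 ≤ M := (norm_nonneg _).trans (hM ∅)
  have hsum : ∀ a : C₀(ι, ℝ), Summable fun i => a i • z i := fun a => by
    rw [summable_iff_vanishing_norm]
    intro ε hε
    have hc : 0 < ε / (M + 1) := by positivity
    refine ⟨(a.finite_le_abs hc).toFinset, fun F hF => ?_⟩
    have h1 := hsumle a F (ε / (M + 1)) hc.le fun i hi => by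
      have := Finset.disjoint_left.1 hF hi
      rw [Set.Finite.mem_toFinset, Set.mem_ofPred_eq, not_le] at this
      exact this.le
    have h2 : ε / (M + 1) * (M + 1) = ε := by field_simp
    nlinarith
  let Φ : E →L[ℝ] C₀(ι, ℝ) := LinearMap.mkContinuous
    { toFun := fun x => nullFamily (fun i => h i x) (hfin x)
      map_add' := fun x y => by ext i; simp
      map_smul' := fun c x => by ext i; simp } δ⁻¹ fun x =>
    ZeroAtInftyContinuousMap.norm_le_of_forall _ (by positivity) fun i => hle i x
  let J : C₀(ι, ℝ) →L[ℝ] E := LinearMap.mkContinuous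
    { toFun := fun a => ∑' i, a i • z i
      map_add' := fun a b => by
        rw [← (hsum a).tsum_add (hsum b)]
        simp only [ZeroAtInftyContinuousMap.add_apply, add_smul]
      map_smul' := fun c a => by
        rw [RingHom.id_apply, ← (hsum a).tsum_const_smul]
        simp only [ZeroAtInftyContinuousMap.smul_apply, smul_assoc] } M fun a => by
    refine le_of_tendsto' (hsum a).hasSum.norm fun F => ?_
    rw [mul_comm]
    exact hsumle a F ‖a‖ (norm_nonneg _) fun i _ => a.abs_apply_le_norm i
  have hΦ : ∀ x i, Φ x i = h i x := fun _ _ => rfl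
  have hJ : ∀ a : C₀(ι, ℝ), J a = ∑' i, a i • z i := fun _ => rfl
  refine ⟨Φ, J, fun a => ?_, fun x hx i => ?_, fun a ha => ?_⟩
  · ext i
    rw [hΦ, hJ, (h i).map_tsum (hsum a), tsum_eq_single i fun j hj => by
      rw [map_smul, hdis i (z j) (hd hj), smul_zero]]
    rw [map_smul, hzz, smul_eq_mul, mul_one]
  · exact hpos i x hx
  · exact tsum_nonneg fun i => smul_nonneg (ha i) (hz0 i)

end NullFamilies

section BoundedSequences

open BoundedContinuousFunction

/-- In a countably order complete Banach lattice an order bounded disjoint sequence bounded away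
from zero spans a positively complemented copy of the bounded sequences. With `S n` the partial sums
of the sequence and `s` their supremum, the image `w` of a bounded sequence `a` is determined by
`|w - ∑ k < n, a k • z k| ≤ C • (s - S n)` for some constant `C` and all `n`. -/
lemma exists_retract_boundedSequences (hE : IsCountablyOrderComplete E) {z : ℕ → E} {u : E} {δ : ℝ}
    (hδ : 0 < δ) (hz0 : ∀ i, 0 ≤ z i) (hzu : ∀ i, z i ≤ u)
    (hd : Pairwise fun i j => z i ⊓ z j = 0) (hzδ : ∀ i, δ ≤ ‖z i‖) :
    ∃ (Φ : E →L[ℝ] (ℕ →ᵇ ℝ)) (J : (ℕ →ᵇ ℝ) →L[ℝ] E), (∀ a, Φ (J a) = a) ∧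
      (∀ x, 0 ≤ x → ∀ i, 0 ≤ Φ x i) ∧ ∀ a : ℕ →ᵇ ℝ, (∀ i, 0 ≤ a i) → 0 ≤ J a := by
  obtain ⟨h, hpos, hle, hzz, hdis, -⟩ := exists_coordinate_functionals hδ hz0 hzδ
  have hu : 0 ≤ u := (hz0 0).trans (hzu 0)
  let S : ℕ → E := fun n => ∑ k ∈ Finset.range n, z k
  have hSmono : Monotone S := fun m n hmn =>
    Finset.sum_le_sum_of_subset_of_nonneg (Finset.range_mono hmn) fun k _ _ => hz0 k
  obtain ⟨s, hs⟩ := hE (Set.range S) (Set.countable_range S) (Set.range_nonempty S)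
    ⟨u, by rintro _ ⟨n, rfl⟩; exact sum_le_of_pairwise_inf_eq_zero hd hu hz0 hzu _⟩
  have hSs : ∀ n, S n ≤ s := fun n => hs.1 ⟨n, rfl⟩
  have hrem : ∀ n, 0 ≤ s - S n := fun n => sub_nonneg.2 (hSs n)
  -- The remainders `s - S n` decrease to zero.
  have hzero : ∀ (d : E) (C : ℝ), (∀ n, d ≤ C • (s - S n)) → d ≤ 0 := fun d C hdC => by
    have hC : 0 < |C| + 1 := by positivity
    have h1 : ∀ n, (|C| + 1)⁻¹ • d ≤ s - S n := fun n => by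
      have h2 : d ≤ (|C| + 1) • (s - S n) := (hdC n).trans
        (smul_le_smul_of_nonneg_right (by linarith [le_abs_self C]) (hrem n))
      have h3 := smul_le_smul_of_nonneg_left h2 (inv_nonneg.2 hC.le)
      rwa [smul_smul, inv_mul_cancel₀ hC.ne', one_smul] at h3
    have h2 : s ≤ s - (|C| + 1)⁻¹ • d := hs.2 (by
      rintro _ ⟨n, rfl⟩
      exact le_sub_comm.1 (h1 n))
    have h3 : (|C| + 1)⁻¹ • d ≤ 0 := by simpa using h2
    have h4 := smul_le_smul_of_nonneg_left h3 hC.le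
    rwa [smul_smul, mul_inv_cancel₀ hC.ne', one_smul, smul_zero] at h4
  have hremdis : ∀ k n, k < n → (s - S n) ⊓ z k = 0 := fun k n hkn => by
    refine isLUB_inf_eq_zero (A := {x | ∃ m, n ≤ m ∧ x = S m - S n}) ⟨?_, ?_⟩
      ⟨_, n, le_rfl, rfl⟩ ?_
    · rintro _ ⟨m, -, rfl⟩
      exact sub_le_sub_right (hSs m) _
    · intro b hb
      have hb0 : 0 ≤ b := by simpa using hb ⟨n, le_rfl, rfl⟩
      rw [sub_le_iff_le_add]
      refine hs.2 ?_
      rintro _ ⟨m, rfl⟩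
      rcases le_total n m with hnm | hmn
      · exact sub_le_iff_le_add.1 (hb ⟨m, hnm, rfl⟩)
      · exact (hSmono hmn).trans (le_add_of_nonneg_left hb0)
    · rintro _ ⟨m, hnm, rfl⟩
      rw [show S m - S n = ∑ j ∈ Finset.Ico n m, z j from
        (Finset.sum_Ico_eq_sub z hnm).symm]
      exact sum_inf_eq_zero (hz0 k) _ fun j hj => hd (by
        have := (Finset.mem_Ico.1 hj).1
        omega)
  have hex : ∀ a : ℕ →ᵇ ℝ, ∃ w : E, ∀ n,
      |w - ∑ k ∈ Finset.range n, a k • z k| ≤ ‖a‖ • (s - S n) := fun a => by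
    let B : ℕ → E := fun n => ∑ k ∈ Finset.range n, (a k + ‖a‖) • z k
    have hBS : ∀ n, B n = ∑ k ∈ Finset.range n, a k • z k + ‖a‖ • S n := fun n => by
      simp only [B, S, add_smul, Finset.sum_add_distrib, Finset.smul_sum]
    have ha : ∀ k, -‖a‖ ≤ a k ∧ a k ≤ ‖a‖ := fun k => abs_le.1 (a.norm_coe_le_norm k)
    have hBmono : Monotone B := fun m n hmn =>
      Finset.sum_le_sum_of_subset_of_nonneg (Finset.range_mono hmn) fun k _ _ =>
        smul_nonneg (by linarith [(ha k).1]) (hz0 k)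
    have hBinc : ∀ n m, B m ≤ B n + (2 * ‖a‖) • (s - S n) := fun n m => by
      rcases le_total n m with hnm | hmn
      · have h1 : B m - B n ≤ (2 * ‖a‖) • (S m - S n) := by
          simp only [B, S]
          rw [← Finset.sum_Ico_eq_sub _ hnm, ← Finset.sum_Ico_eq_sub _ hnm, Finset.smul_sum]
          exact Finset.sum_le_sum fun k _ =>
            smul_le_smul_of_nonneg_right (by linarith [(ha k).2]) (hz0 k)
        refine sub_le_iff_le_add'.1 (h1.trans ?_)
        exact smul_le_smul_of_nonneg_left (sub_le_sub_right (hSs m) _) (by positivity)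
      · exact (hBmono hmn).trans (le_add_of_nonneg_right (smul_nonneg (by positivity) (hrem n)))
    obtain ⟨β, hβ⟩ := hE (Set.range B) (Set.countable_range B) (Set.range_nonempty B)
      ⟨_, by rintro _ ⟨m, rfl⟩; exact hBinc 0 m⟩
    refine ⟨β - ‖a‖ • s, fun n => ?_⟩
    have h1 : β - ‖a‖ • s - ∑ k ∈ Finset.range n, a k • z k = (β - B n) - ‖a‖ • (s - S n) := by
      rw [hBS, smul_sub]
      abel
    have h2 : B n ≤ β := hβ.1 ⟨n, rfl⟩
    have h3 : β ≤ B n + (2 * ‖a‖) • (s - S n) := hβ.2 (by rintro _ ⟨m, rfl⟩; exact hBinc n m)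
    rw [h1, abs_le']
    constructor
    · rw [sub_le_iff_le_add, ← add_smul, ← two_mul]
      exact sub_le_iff_le_add'.2 h3
    · rw [neg_sub]
      exact sub_le_self _ (sub_nonneg.2 h2)
  choose w hw using hex
  have huniq : ∀ (x : E) (C : ℝ), (∀ n, |x| ≤ C • (s - S n)) → x = 0 := fun x C hx =>
    le_antisymm ((le_abs_self x).trans (hzero _ C hx))
      (neg_nonpos.1 ((neg_le_abs x).trans (hzero _ C hx)))
  let J : (ℕ →ᵇ ℝ) →L[ℝ] E := LinearMap.mkContinuous
    { toFun := w
      map_add' := fun a b => by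
        rw [← sub_eq_zero]
        refine huniq _ (‖a + b‖ + (‖a‖ + ‖b‖)) fun n => ?_
        have h1 : w (a + b) - (w a + w b) =
            (w (a + b) - ∑ k ∈ Finset.range n, (a + b) k • z k) -
              ((w a - ∑ k ∈ Finset.range n, a k • z k) +
                (w b - ∑ k ∈ Finset.range n, b k • z k)) := by
          simp only [BoundedContinuousFunction.add_apply, add_smul, Finset.sum_add_distrib]
          abel
        rw [h1, add_smul, add_smul]
        refine (abs_sub_le_abs_add_abs _ _).trans (add_le_add (hw _ n) ((abs_add_le_abs_add_abs _ _).trans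
          (add_le_add (hw a n) (hw b n))))
      map_smul' := fun c a => by
        rw [← sub_eq_zero]
        refine huniq _ (‖c • a‖ + |c| * ‖a‖) fun n => ?_
        have h1 : w (c • a) - c • w a =
            (w (c • a) - ∑ k ∈ Finset.range n, (c • a) k • z k) -
              c • (w a - ∑ k ∈ Finset.range n, a k • z k) := by
          simp only [BoundedContinuousFunction.smul_apply, smul_assoc, smul_sub, Finset.smul_sum]
          abel
        rw [RingHom.id_apply, h1, add_smul, mul_smul]
        refine (abs_sub_le_abs_add_abs _ _).trans (add_le_add (hw _ n) ?_)
        refine (abs_smul_le_abs_smul_abs c _).trans ?_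
        exact smul_le_smul_of_nonneg_left (hw a n) (abs_nonneg c) } ‖s‖ fun a => by
    have h1 := hw a 0
    simp only [S, Finset.range_zero, Finset.sum_empty, sub_zero] at h1
    have h2 : ‖w a‖ ≤ ‖‖a‖ • s‖ := norm_le_norm_of_abs_le_abs (h1.trans (le_abs_self _))
    rw [norm_smul, norm_norm, mul_comm] at h2
    exact h2
  let Φ : E →L[ℝ] (ℕ →ᵇ ℝ) := LinearMap.mkContinuous
    { toFun := fun x => BoundedContinuousFunction.ofNormedAddCommGroupDiscrete
        (fun i => h i x) (δ⁻¹ * ‖x‖) (fun i => hle i x)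
      map_add' := fun x y => by ext i; simp
      map_smul' := fun c x => by ext i; simp } δ⁻¹ fun x =>
    (BoundedContinuousFunction.norm_le (by positivity)).2 fun i => hle i x
  refine ⟨Φ, J, fun a => ?_, fun x hx i => hpos i x hx, fun a ha => ?_⟩
  · ext k
    change h k (w a) = a k
    have h1 := abs_apply_le_apply_abs (hpos k) (w a - ∑ j ∈ Finset.range (k + 1), a j • z j)
    have h2 := hpos k _ (sub_nonneg.2 (hw a (k + 1)))
    rw [map_sub, map_smul, hdis k _ (hremdis k (k + 1) (Nat.lt_succ_self k)), smul_zero] at h2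
    have h3 : h k (∑ j ∈ Finset.range (k + 1), a j • z j) = a k := by
      rw [map_sum, Finset.sum_eq_single k]
      · rw [map_smul, hzz, smul_eq_mul, mul_one]
      · intro j _ hj
        rw [map_smul, hdis k (z j) (hd hj), smul_zero]
      · intro hk
        simp at hk
    rw [map_sub, h3] at h1
    exact sub_eq_zero.1 (abs_nonpos_iff.1 (by linarith))
  · have h1 := hzero (-(w a)) ‖a‖ fun n => by
      refine le_trans ?_ ((neg_le_abs _).trans (hw a n))
      rw [neg_sub, neg_eq_zero_sub]
      exact sub_le_sub_right (Finset.sum_nonneg fun k _ => smul_nonneg (ha k) (hz0 k)) _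
    exact neg_nonpos.1 h1

end BoundedSequences

end Embeddings

/-! ### The KB-property -/

theorem theorem3p2 {E : Type*} [NormedAddCommGroup E] [NormedSpace ℝ E] [CompleteSpace E]
    [Lattice E] [IsOrderedAddMonoid E] [IsOrderedModule ℝ E] [HasSolidNorm E]
    (hE : IsCountablyOrderComplete E)
    (hT : ∀ T : E →L[ℝ] E, IsPositiveOperator T → IsPowerBounded T → IsMeanErgodic T →
      IsWeaklyAlmostPeriodic T) :
    IsKBSpace E := by
  by_contra hKB
  by_cases hoc : ∀ (u : E) (z : ℕ → E), (∀ n, 0 ≤ z n) → (∀ n, z n ≤ u) →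
      (Pairwise fun i j => z i ⊓ z j = 0) → Tendsto z atTop (𝓝 0)
  · obtain ⟨y, M, δ, hδ, hy0, hM, hyδ⟩ := exists_increments_of_not_isKBSpace hKB
    obtain ⟨z, hz0, hd, hzM, hzδ⟩ := exists_disjoint_of_norm_bounded hoc hδ hy0 hM hyδ
    let c : ℕ ⊕ ℕ × ℕ → ℕ := Encodable.encode
    have hc : Function.Injective c := Encodable.encode_injective
    obtain ⟨Φ, J, hΦJ, hΦ, hJ⟩ := exists_retract_nullFamilies hoc (z := fun i => z (c i)) (M := M)
      (half_pos hδ) (fun i => hz0 _) (fun i j hij => hd (hc.ne hij)) (fun F => by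
        rw [← Finset.sum_image fun i _ j _ h => hc h]
        exact hzM _) (fun i => hzδ _)
    exact not_isWeaklyAlmostPeriodic_shiftFeedCLM (isWeaklyAlmostPeriodic_of_retract hT Φ J hΦJ _
      (fun x hx => hJ _ (shiftFeedCLM_nonneg (hΦ x hx))) isPowerBounded_shiftFeedCLM
      fun a => ⟨0, tendsto_average_shiftFeedCLM a⟩)
  · push Not at hoc
    obtain ⟨u, z, hz0, hzu, hd, hlim⟩ := hoc
    rw [Metric.tendsto_atTop] at hlim
    push Not at hlim
    obtain ⟨δ, hδ, hfr⟩ := hlim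
    obtain ⟨φ, hφ, hφδ⟩ := extraction_of_frequently_atTop (frequently_atTop.2 hfr)
    obtain ⟨Φ, J, hΦJ, hΦ, hJ⟩ := exists_retract_boundedSequences hE (z := fun n => z (φ n))
      hδ (fun i => hz0 _) (fun i => hzu _) (fun i j hij => hd (hφ.injective.ne hij))
      (fun i => by simpa using hφδ i)
    obtain ⟨D, hDpos, hDpb, hDme, hDw⟩ := exists_boundedSequence_operator
    exact hDw (isWeaklyAlmostPeriodic_of_retract hT Φ J hΦJ D
      (fun x hx => hJ _ (hDpos _ (hΦ x hx))) hDpb hDme)
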